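/- Let $S\subset\mathbb R^3$ be a regular (embedded) $C^2$ surface, $\mathbf p\in S$, and let $G$ be the Gaussian curvature of $S$ at $\mathbf p$. Let $\mathbf p_1,\dots,\mathbf p_n\in S$ be the one-ring neighbours of $\mathbf p$ in a triangulation of $S$ around $\mathbf p$ ($\mathbf p_{n+1}=\mathbf p_1$, $\mathbf p_0=\mathbf p_n$): with $\mathbf q_i$ the orthogonal projection of $\mathbf p_i$ onto the tangent plane at $\mathbf p$, the triangles $\mathbf q_i\mathbf p\mathbf q_{i+1}$ are nondegenerate, equally oriented, and go around $\mathbf p$ exactly once. Put $\eta_i=\|\mathbf p_i-\mathbf p\|$, $\gamma_i=\angle\mathbf p_i\mathbf p\mathbf p_{i+1}$, $\beta_i=\angle\mathbf q_i\mathbf p\mathbf q_{i+1}$, $\alpha_i=\angle\mathbf p_i\mathbf p_{i-1}\mathbf p$, $\delta_i=\angle\mathbf p_i\mathbf p_{i+1}\mathbf p$, $\varphi_i=\sum_{j=1}^i\gamma_j$ (with $\gamma_{n+1}=\gamma_1$), and, with sums over $i=1,\dots,n$, $$H^{(1)}=2\left\|\frac{\sum_i(\cot\alpha_i+\cot\delta_i)(\mathbf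 p_i-\mathbf p)}{\sum_i(\cot\alpha_i+\cot\delta_i)\eta_i^2}\right\|,\qquad S_p=\sum_i\frac1{4\sin\gamma_i}\Big[\eta_i\eta_{i+1}-\frac{\cos\gamma_i}2(\eta_i^2+\eta_{i+1}^2)\Big],$$ $$A=\sum_i\frac1{4\sin\gamma_i}\Big[\frac{\eta_i\eta_{i+1}}2\big(1-\cos2\varphi_i\cos2\varphi_{i+1}\big)-\frac{\cos\gamma_i}4\big(\eta_i^2\sin^2\varphi_i+\eta_{i+1}^2\sin^2\varphi_{i+1}\big)\Big],$$ $$G^{(5)}=\frac{2\pi-\sum_i\gamma_i-2(S_p-A)(H^{(1)})^2}{2A-S_p}.$$ Consider any family of such one-rings of $\mathbf p$ on $S$, of fixed valence $n$, along which $\eta_i\to0$ for every $i$. Then $G^{(5)}\to G$ in each of the following two cases. (1) $n\ge5$ and $\mathbf p$ is a regular vertex of each one-ring of the family: $\beta_i=2\pi/n$ for all $i$, and all $\eta_i$ are equal. (2) $\mathbf p$ is an umbilical point of $S$ (the two principal curvatures at $\mathbf p$ coincide), the valence $n$ is arbitrary, and the one-rings are nondegenerate: for some constant $c>0$ independent of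 the member of the family, $\sin\gamma_i\ge c$, $|S_p|\ge c\,\eta_i^2$ and $|2A-S_p|\ge c\,\eta_i^2$ for all $i$. (Here $8S_p$ is the denominator $\sum_i(\cot\alpha_i+\cot\delta_i)\eta_i^2$ of $H^{(1)}$, and $2A-S_p$ is the denominator of $G^{(5)}$.) -/

import Mathlib

open Filter Topology

/-- The parameter plane. -/
abbrev E2 : Type := EuclideanSpace ℝ (Fin 2)

/-- The ambient Euclidean space. -/
abbrev E3 : Type := EuclideanSpace ℝ (Fin 3)

noncomputable section

/-! ### Surfaces in space and their curvature -/

/-- `F : U → S` is a `C²` local parametrization, around the point `F u₀`, of the (embedded, regular)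
surface `S`: a `C²` immersion of the open set `U ∋ u₀` that is a homeomorphism of `U` onto a
relatively open part of `S`. -/
structure IsLocalParametrization (S : Set E3) (U : Set E2) (F : E2 → E3) (u₀ : E2) : Prop where
  isOpen : IsOpen U
  mem : u₀ ∈ U
  contDiffOn : ContDiffOn ℝ 2 F U
  immersion : ∀ u ∈ U, Function.Injective (fderiv ℝ F u)
  embedding : Topology.IsEmbedding (U.domRestrict F)
  image : ∃ V : Set E3, IsOpen V ∧ F '' U = S ∩ V

/-- The cross product on Euclidean space. -/
def cross (v w : E3) : E3 := WithLp.toLp 2 (crossProduct v.ofLp w.ofLp)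

/-- The first (`j = 0`) and second (`j = 1`) coordinate vectors of the parameter plane. -/
def coordVec (j : Fin 2) : E2 := EuclideanSpace.single j (1 : ℝ)

/-- The unit normal `F₁ × F₂ / ‖F₁ × F₂‖` of the parametrized surface `F`. -/
def unitNormal (F : E2 → E3) (u : E2) : E3 :=
  let c := cross (fderiv ℝ F u (coordVec 0)) (fderiv ℝ F u (coordVec 1))
  ‖c‖⁻¹ • c

/-- First fundamental form. -/
def firstForm (F : E2 → E3) (u v w : E2) : ℝ :=
  inner ℝ (fderiv ℝ F u v) (fderiv ℝ F u w)

/-- Second fundamental form. -/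
def secondForm (F : E2 → E3) (u v w : E2) : ℝ :=
  inner ℝ (fderiv ℝ (fderiv ℝ F) u v w) (unitNormal F u)

/-- Gaussian curvature `det II / det I`. -/
def gaussianCurvature (F : E2 → E3) (u : E2) : ℝ :=
  (secondForm F u (coordVec 0) (coordVec 0) * secondForm F u (coordVec 1) (coordVec 1)
      - secondForm F u (coordVec 0) (coordVec 1) ^ 2) /
    (firstForm F u (coordVec 0) (coordVec 0) * firstForm F u (coordVec 1) (coordVec 1)
      - firstForm F u (coordVec 0) (coordVec 1) ^ 2)

/-- `k` is a principal curvature: an eigenvalue of the shape operator, that is, of the second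
fundamental form relative to the first. -/
def IsPrincipalCurvature (F : E2 → E3) (u : E2) (k : ℝ) : Prop :=
  ∃ v : E2, v ≠ 0 ∧ ∀ w : E2, secondForm F u v w = k * firstForm F u v w

/-- The point is umbilical: the two principal curvatures coincide. -/
def IsUmbilical (F : E2 → E3) (u : E2) : Prop :=
  ∀ k k' : ℝ, IsPrincipalCurvature F u k → IsPrincipalCurvature F u k' → k = k'

/-! ### One-rings

A vertex `p` of valence `n` has neighbours `p_1, …, p_n`, with the conventions `p_{n+1} = p_1` and
`p_0 = p_n`. They are given by a function `P` on `ZMod n`; `p_i` is `P i`. -/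

section Ring

variable {n : ℕ} (p : E3) (P : ZMod n → E3)

/-- The edge length `η_i = ‖p_i - p‖`. -/
def edgeLength (i : ZMod n) : ℝ := dist p (P i)

/-- `γ_i = ∠ p_i p p_{i+1}`. -/
def gammaAngle (i : ZMod n) : ℝ := EuclideanGeometry.angle (P i) p (P (i + 1))

/-- `α_i = ∠ p_i p_{i-1} p`. -/
def alphaAngle (i : ZMod n) : ℝ := EuclideanGeometry.angle (P i) (P (i - 1)) p

/-- `δ_i = ∠ p_i p_{i+1} p`. -/
def deltaAngle (i : ZMod n) : ℝ := EuclideanGeometry.angle (P i) (P (i + 1)) p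

/-- The cotangent weight `cot α_i + cot δ_i`. -/
def cotWeight (i : ZMod n) : ℝ := Real.cot (alphaAngle p P i) + Real.cot (deltaAngle p P i)

/-- `φ_i = γ_1 + ⋯ + γ_i` (used for `1 ≤ i ≤ n + 1`). -/
def phiAngle (i : ℕ) : ℝ := ∑ j ∈ Finset.Icc 1 i, gammaAngle p P (j : ZMod n)

/-- The angular defect `2π - ∑ γ_i`. -/
def angularDefect : ℝ := 2 * Real.pi - ∑ i ∈ Finset.Icc 1 n, gammaAngle p P (i : ZMod n)

/-- The cotangent scheme `H⁽¹⁾` for the mean curvature. -/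
def meanScheme : ℝ :=
  2 * ‖(∑ i ∈ Finset.Icc 1 n, cotWeight p P (i : ZMod n) * edgeLength p P (i : ZMod n) ^ 2)⁻¹ •
      ∑ i ∈ Finset.Icc 1 n, cotWeight p P (i : ZMod n) • (P (i : ZMod n) - p)‖

/-- The module `S_p` of the mesh at `p`. -/
def meshModule : ℝ :=
  ∑ i ∈ Finset.Icc 1 n,
    1 / (4 * Real.sin (gammaAngle p P (i : ZMod n))) *
      (edgeLength p P (i : ZMod n) * edgeLength p P ((i : ZMod n) + 1)
        - Real.cos (gammaAngle p P (i : ZMod n)) / 2 *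
          (edgeLength p P (i : ZMod n) ^ 2 + edgeLength p P ((i : ZMod n) + 1) ^ 2))

/-- The trigonometric sum `A`. -/
def trigSum : ℝ :=
  ∑ i ∈ Finset.Icc 1 n,
    1 / (4 * Real.sin (gammaAngle p P (i : ZMod n))) *
      (edgeLength p P (i : ZMod n) * edgeLength p P ((i : ZMod n) + 1) / 2 *
          (1 - Real.cos (2 * phiAngle p P i) * Real.cos (2 * phiAngle p P (i + 1)))
        - Real.cos (gammaAngle p P (i : ZMod n)) / 4 *
          (edgeLength p P (i : ZMod n) ^ 2 * Real.sin (phiAngle p P i) ^ 2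
            + edgeLength p P ((i : ZMod n) + 1) ^ 2 * Real.sin (phiAngle p P (i + 1)) ^ 2))

/-- The scheme `G⁽⁵⁾` for the Gaussian curvature. -/
def gaussScheme : ℝ :=
  (angularDefect p P - 2 * (meshModule p P - trigSum p P) * meanScheme p P ^ 2) /
    (2 * trigSum p P - meshModule p P)

end Ring

/-- Orthogonal projection of `x` onto the tangent plane of `F` at the point `F u`. -/
def tangentProj (F : E2 → E3) (u : E2) (x : E3) : E3 :=
  x - inner ℝ (x - F u) (unitNormal F u) • unitNormal F u

/-- `β_i = ∠ q_i p q_{i+1}`, where `p = F u` and `q_i` is the projection of `p_i` onto the tangent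
plane at `p`. -/
def betaAngle {n : ℕ} (F : E2 → E3) (u : E2) (P : ZMod n → E3) (i : ZMod n) : ℝ :=
  EuclideanGeometry.angle (tangentProj F u (P i)) (F u) (tangentProj F u (P (i + 1)))

/-- The signed (doubled) area of the projected triangle `p q_i q_{i+1}` in the tangent plane. -/
def signedArea {n : ℕ} (F : E2 → E3) (u : E2) (P : ZMod n → E3) (i : ZMod n) : ℝ :=
  inner ℝ (cross (tangentProj F u (P i) - F u) (tangentProj F u (P (i + 1)) - F u))
    (unitNormal F u)

/-- The points `p_i = P i` of the surface `S` are the one-ring neighbours of the vertex `p = F u` in a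
triangulation of `S` around `p`: seen in the tangent plane at `p`, the triangles `p_i p p_{i+1}` are
non-degenerate, all have the same orientation, and together go around `p` exactly once. -/
structure IsOneRing {n : ℕ} (S : Set E3) (F : E2 → E3) (u : E2) (P : ZMod n → E3) : Prop where
  mem : ∀ i, P i ∈ S
  oriented : (∀ i, 0 < signedArea F u P i) ∨ (∀ i, signedArea F u P i < 0)
  winding : ∑ i ∈ Finset.Icc 1 n, betaAngle F u P (i : ZMod n) = 2 * Real.pi

/-- Regular vertex: all `β_i` are `2π/n` and all edge lengths `η_i` take the same value. -/
structure IsRegularVertex {n : ℕ} (F : E2 → E3) (u : E2) (P : ZMod n → E3) : Prop where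
  angles : ∀ i, betaAngle F u P i = 2 * Real.pi / n
  lengths : ∀ i j, edgeLength (F u) P i = edgeLength (F u) P j

/-- A one-ring is nondegenerate with constant `c`: the angles `γ_i` stay away from `0` and `π`, and the
quantities `S_p` (one eighth of the denominator of the cotangent scheme) and `2A - S_p` are not small
compared with `η_i ^ 2`. -/
structure IsNondegenerate {n : ℕ} (c : ℝ) (p : E3) (P : ZMod n → E3) : Prop where
  sin_gamma : ∀ i, c ≤ Real.sin (gammaAngle p P i)
  module : ∀ i, c * edgeLength p P i ^ 2 ≤ |meshModule p P|
  denominator : ∀ i, c * edgeLength p P i ^ 2 ≤ |2 * trigSum p P - meshModule p P|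

end

noncomputable section

/-! ### The cross product and adapted orthonormal frames -/

/-! In a complex coordinate on the tangent plane at p, the second fundamental form is H|z|² + Re(D
z²) (`planeForm`), and the Gaussian curvature is H² − ‖D‖². By Taylor expansion, the edge to p_i
leaves the tangent plane at an angle of sine s_i = κ_i η_i / 2 + o(δ), where κ_i is the normal
curvature in the direction of the edge and δ is the sum of the edge lengths
(`elevation_sub_isLittleO`). Two expansions in the s_i then decide everything.

Angular defect: since the β_i add up to 2π, the defect is the sum of the β_i − γ_i. The cosine law
relating β_i, γ_i and the elevations gives β − γ = (s s' − (cos γ / 2)(s² + s'²)) / sin γ up to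
fourth order (`angle_defect_bound`, `angularDefect_sub_isLittleO`).

Cotangent vector: grouped by triangles, its tangential part is to leading order a sum of rotated
edges of the projected polygon, which telescopes to zero; the error is of third order
(`area_gradient_bound`). Its normal part is linear in the s_i (`sum_cotWeight_sub_isLittleO`).

By `tendsto_gaussScheme` it suffices that, up to o(δ²), the cotangent vector is 4 H S_p ν and the
defect is G(2A − S_p) + 2(S_p − A)H², with S_p and 2A − S_p of exact order δ². At an umbilic all κ_i
equal H, both expansions are multiples of S_p, and A cancels. At a regular vertex γ_i tends to b =
2π/n, and the sums of κ_i, κ_i² and κ_i κ_{i+1} are evaluated by summing powers of a rotation around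
the regular polygon (`IsOneRing.sum_normalCurv`, `sum_trig_regular`); the limits match after
division by η². -/

theorem inner_eq_coords (x y : E3) : inner ℝ x y = x 0 * y 0 + x 1 * y 1 + x 2 * y 2 := by
  rw [PiLp.inner_apply, Fin.sum_univ_three]
  simp [mul_comm]

theorem cross_apply_zero (v w : E3) : cross v w 0 = v 1 * w 2 - v 2 * w 1 := by
  simp [cross, cross_apply]

theorem cross_apply_one (v w : E3) : cross v w 1 = v 2 * w 0 - v 0 * w 2 := by
  simp [cross, cross_apply]

theorem cross_apply_two (v w : E3) : cross v w 2 = v 0 * w 1 - v 1 * w 0 := by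
  simp [cross, cross_apply]

/-- Lagrange's identity, the source of the Gram determinants and of the oriented area below. -/
theorem inner_cross_cross (u v w x : E3) :
    inner ℝ (cross u v) (cross w x) =
      inner ℝ u w * inner ℝ v x - inner ℝ u x * inner ℝ v w := by
  simp only [inner_eq_coords, cross_apply_zero, cross_apply_one, cross_apply_two]
  ring

theorem inner_cross_left (v w : E3) : inner ℝ v (cross v w) = 0 := by
  simp only [inner_eq_coords, cross_apply_zero, cross_apply_one, cross_apply_two]
  ring

theorem inner_cross_right (v w : E3) : inner ℝ w (cross v w) = 0 := by
  simp only [inner_eq_coords, cross_apply_zero, cross_apply_one, cross_apply_two]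
  ring

theorem inner_cross_cyclic (u v w : E3) :
    inner ℝ (cross u v) w = inner ℝ u (cross v w) := by
  simp only [inner_eq_coords, cross_apply_zero, cross_apply_one, cross_apply_two]
  ring

/-- `e × (ν × e) = ν` for orthonormal `ν, e`. -/
theorem cross_cross_self {ν e : E3} (he : inner ℝ e e = 1) (hνe : inner ℝ ν e = 0) :
    cross e (cross ν e) = ν := by
  rw [inner_eq_coords] at he hνe
  ext i
  fin_cases i
  · simp only [Fin.zero_eta, cross_apply_zero, cross_apply_one, cross_apply_two]
    linear_combination ν 0 * he - e 0 * hνe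
  · simp only [Fin.mk_one, cross_apply_zero, cross_apply_one, cross_apply_two]
    linear_combination ν 1 * he - e 1 * hνe
  · simp only [Fin.reduceFinMk, cross_apply_zero, cross_apply_one, cross_apply_two]
    linear_combination ν 2 * he - e 2 * hνe

/-- Parseval's identity in the frame `e, ν × e, ν`. -/
theorem inner_eq_of_frame {ν e : E3} (hν : inner ℝ ν ν = 1) (he : inner ℝ e e = 1)
    (hνe : inner ℝ ν e = 0) (x y : E3) :
    inner ℝ x y = inner ℝ e x * inner ℝ e y + inner ℝ (cross ν e) x * inner ℝ (cross ν e) y +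
      inner ℝ x ν * inner ℝ y ν := by
  have hc : inner ℝ (cross ν e) (cross ν e) = 1 := by
    rw [inner_cross_cross, hν, he, hνe]; ring
  have h1 : inner ℝ e (cross ν e) = 0 := inner_cross_right ν e
  have h2 : inner ℝ ν (cross ν e) = 0 := inner_cross_left ν e
  have ho : Orthonormal ℝ ![e, cross ν e, ν] := by
    rw [orthonormal_iff_ite]
    intro i j
    fin_cases i <;> fin_cases j <;>
      simp [-inner_self_eq_norm_sq_to_K, hν, he, hνe, hc, h1, h2, real_inner_comm ν e,
        real_inner_comm e (cross ν e), real_inner_comm ν (cross ν e)]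
  have hcard : Fintype.card (Fin 3) = Module.finrank ℝ E3 := by simp
  let b := (basisOfOrthonormalOfCardEqFinrank ho hcard).toOrthonormalBasis
    (by simpa using ho)
  have hb : ∀ i, b i = ![e, cross ν e, ν] i := by intro i; simp [b]
  rw [← b.sum_inner_mul_inner x y, Fin.sum_univ_three, hb, hb, hb]
  simp [real_inner_comm x, real_inner_comm y ν]

/-- The complex coordinate `⟨e, x⟩ + i ⟨ν × e, x⟩` in the plane orthogonal to `ν`. -/
def planeCoord (ν e : E3) : E3 →L[ℝ] ℂ :=
  (innerSL ℝ e).smulRight (1 : ℂ) + (innerSL ℝ (cross ν e)).smulRight Complex.I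

theorem planeCoord_re (ν e x : E3) : (planeCoord ν e x).re = inner ℝ e x := by
  simp [planeCoord]

theorem planeCoord_im (ν e x : E3) : (planeCoord ν e x).im = inner ℝ (cross ν e) x := by
  simp [planeCoord]

theorem inner_eq_planeCoord {ν e : E3} (hν : inner ℝ ν ν = 1) (he : inner ℝ e e = 1)
    (hνe : inner ℝ ν e = 0) (x y : E3) :
    inner ℝ x y = (starRingEnd ℂ (planeCoord ν e x) * planeCoord ν e y).re +
      inner ℝ x ν * inner ℝ y ν := by
  rw [inner_eq_of_frame hν he hνe x y]
  simp [planeCoord_re, planeCoord_im]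

/-- Writing ν as e × (ν × e) reduces the triple product to Lagrange's identity, which is the 2 × 2
determinant of the plane coordinates. -/
theorem inner_cross_eq_planeCoord {ν e : E3} (he : inner ℝ e e = 1)
    (hνe : inner ℝ ν e = 0) (x y : E3) :
    inner ℝ (cross x y) ν = (starRingEnd ℂ (planeCoord ν e x) * planeCoord ν e y).im := by
  conv_lhs => rw [← cross_cross_self he hνe]
  rw [inner_cross_cross]
  simp [planeCoord_re, planeCoord_im, real_inner_comm x, real_inner_comm y]
  ring

/-! ### Second order Taylor expansion -/

/-- The second order Taylor expansion of a map that is `C²` at a point. -/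
theorem ContDiffAt.taylor_two_isLittleO {X Y : Type*} [NormedAddCommGroup X] [NormedSpace ℝ X]
    [NormedAddCommGroup Y] [NormedSpace ℝ Y] {f : X → Y} {a : X} (hf : ContDiffAt ℝ 2 f a) :
    (fun u => f u - f a - fderiv ℝ f a (u - a)
      - (2⁻¹ : ℝ) • fderiv ℝ (fderiv ℝ f) a (u - a) (u - a)) =o[𝓝 a]
      fun u => ‖u - a‖ ^ 2 := by
  set A := fderiv ℝ (fderiv ℝ f) a with hA
  have hsymm : ∀ v w, A v w = A w v := fun v w =>
    (hf.isSymmSndFDerivAt (by simp)).eq v w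
  have hdiff : HasFDerivAt (fderiv ℝ f) A a :=
    ((hf.fderiv_right (m := 1) (by norm_num)).differentiableAt (by norm_num)).hasFDerivAt
  have hd : ∀ᶠ u in 𝓝 a, DifferentiableAt ℝ f u := by
    filter_upwards [hf.eventually (by simp)] with u hu
    exact hu.differentiableAt (by norm_num)
  rw [Asymptotics.isLittleO_iff]
  intro ε hε
  have hlo := (Asymptotics.isLittleO_iff.1 hdiff.isLittleO) hε
  obtain ⟨r, hr, hball⟩ := Metric.eventually_nhds_iff_ball.1 (hlo.and hd)
  filter_upwards [Metric.ball_mem_nhds a hr] with u hu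
  set g : X → Y := fun u => f u - f a - fderiv ℝ f a (u - a) - (2⁻¹ : ℝ) • A (u - a) (u - a)
  -- The derivative of the remainder is the first-order remainder of `fderiv ℝ f`: by symmetry of
  -- `A` the product rule gives twice the same term, which cancels the factor 1/2. The mean value
  -- inequality on this ball then supplies the second factor ‖u − a‖.
  have hg : ∀ x ∈ Metric.closedBall a ‖u - a‖,
      HasFDerivWithinAt g (fderiv ℝ f x - fderiv ℝ f a - A (x - a))
        (Metric.closedBall a ‖u - a‖) x := by
    intro x hx
    have hxr : x ∈ Metric.ball a r := by
      rw [Metric.mem_ball, dist_eq_norm] at *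
      rw [Metric.mem_closedBall, dist_eq_norm] at hx
      linarith
    have h1 := (hball x hxr).2.hasFDerivAt
    have h2 : HasFDerivAt (fun u : X => u - a) (ContinuousLinearMap.id ℝ X) x :=
      (hasFDerivAt_id x).sub_const a
    have h3 : HasFDerivAt (fun u => fderiv ℝ f a (u - a)) (fderiv ℝ f a) x := by
      have h := (fderiv ℝ f a).hasFDerivAt.comp x h2
      rwa [ContinuousLinearMap.comp_id] at h
    have h4 : HasFDerivAt (fun u => A (u - a)) A x := by
      have h := A.hasFDerivAt.comp x h2
      rwa [ContinuousLinearMap.comp_id] at h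
    have h5 := (h4.clm_apply h2).const_smul (2⁻¹ : ℝ)
    have h6 := ((h1.sub_const (f a)).sub h3).sub h5
    refine HasFDerivAt.hasFDerivWithinAt (h6.congr_fderiv ?_)
    ext v
    simp only [sub_apply, smul_apply, add_apply, ContinuousLinearMap.comp_apply,
      ContinuousLinearMap.flip_apply, ContinuousLinearMap.id_apply, hsymm v (x - a)]
    rw [← two_smul ℝ, smul_smul]
    norm_num
  have hbound : ∀ x ∈ Metric.closedBall a ‖u - a‖,
      ‖fderiv ℝ f x - fderiv ℝ f a - A (x - a)‖ ≤ ε * ‖u - a‖ := by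
    intro x hx
    have hxr : x ∈ Metric.ball a r := by
      rw [Metric.mem_ball, dist_eq_norm] at *
      rw [Metric.mem_closedBall, dist_eq_norm] at hx
      linarith
    refine ((hball x hxr).1).trans ?_
    rw [Metric.mem_closedBall, dist_eq_norm] at hx
    gcongr
  have hmv := (convex_closedBall a ‖u - a‖).norm_image_sub_le_of_norm_hasFDerivWithin_le hg hbound
    (x := a) (y := u) (by simp) (by simp [dist_eq_norm])
  have hga : g a = 0 := by simp [g]
  rw [hga, sub_zero] at hmv
  simpa [g, pow_two, mul_assoc] using hmv

/-! ### Surfaces in an adapted frame -/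

/-- The quadratic form `H |z|² + Re (D z²)`: every real quadratic form on the plane is of this shape,
with `H` the half trace and `H² - |D|²` the determinant. -/
def planeForm (H : ℝ) (D : ℂ) (z : ℂ) : ℝ := H * ‖z‖ ^ 2 + (D * z ^ 2).re

theorem planeForm_eq (H : ℝ) (D z : ℂ) :
    planeForm H D z = (H + D.re) * z.re ^ 2 + 2 * (-D.im) * (z.re * z.im) +
      (H - D.re) * z.im ^ 2 := by
  rw [planeForm, Complex.sq_norm, Complex.normSq_apply]
  simp [pow_two]
  ring

/-- Points of a parametrized surface near the base point come from parameters near the base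
parameter. -/
theorem IsLocalParametrization.exists_param_of_dist_lt {S : Set E3} {U : Set E2} {F : E2 → E3}
    {u₀ : E2} (hF : IsLocalParametrization S U F u₀) {p : E2 → Prop} (hp : ∀ᶠ u in 𝓝 u₀, p u) :
    ∃ r > 0, ∀ x ∈ S, dist (F u₀) x < r → ∃ u, p u ∧ F u = x := by
  obtain ⟨V, hV, hUV⟩ := hF.image
  have hp' : ∀ᶠ u : U in 𝓝 (⟨u₀, hF.mem⟩ : U), p u.1 :=
    (continuous_subtype_val.tendsto (⟨u₀, hF.mem⟩ : U)).eventually hp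
  -- The embedding property makes parameters close to u₀ as soon as their images are close to F u₀;
  -- relative openness of the image then accounts for every nearby point of S.
  rw [hF.embedding.isInducing.nhds_eq_comap, eventually_comap] at hp'
  have hFV : F u₀ ∈ V := (hUV ▸ Set.mem_image_of_mem F hF.mem : F u₀ ∈ S ∩ V).2
  have hp'' := hp'.and (hV.mem_nhds hFV)
  obtain ⟨r, hr, hball⟩ := Metric.eventually_nhds_iff_ball.1 hp''
  refine ⟨r, hr, fun x hx hxr => ?_⟩
  obtain ⟨h1, h2⟩ := hball x (by rwa [Metric.mem_ball, dist_comm])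
  obtain ⟨u, huU, rfl⟩ : x ∈ F '' U := hUV ▸ ⟨hx, h2⟩
  exact ⟨u, h1 ⟨u, huU⟩ rfl, rfl⟩

theorem E2.eq_coords (v : E2) : v = v 0 • coordVec 0 + v 1 • coordVec 1 := by
  ext i
  fin_cases i <;> simp [coordVec]

/-- A tangential coordinate system for a parametrized surface at a point, in which the second
fundamental form is `planeForm H D`. -/
theorem exists_tangent_coord {F : E2 → E3} {u₀ : E2} (hF : ContDiffAt ℝ 2 F u₀)
    (hinj : Function.Injective (fderiv ℝ F u₀)) :
    ∃ (Z : E3 →L[ℝ] ℂ) (H : ℝ) (D : ℂ),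
      inner ℝ (unitNormal F u₀) (unitNormal F u₀) = (1 : ℝ) ∧
      (∀ x y, inner ℝ x y = (starRingEnd ℂ (Z x) * Z y).re +
        inner ℝ x (unitNormal F u₀) * inner ℝ y (unitNormal F u₀)) ∧
      (∀ x y, inner ℝ (cross x y) (unitNormal F u₀) = (starRingEnd ℂ (Z x) * Z y).im) ∧
      (∀ v, inner ℝ (fderiv ℝ F u₀ v) (unitNormal F u₀) = 0) ∧
      gaussianCurvature F u₀ = H ^ 2 - ‖D‖ ^ 2 ∧
      (IsUmbilical F u₀ → D = 0) ∧
      ∀ v, secondForm F u₀ v v = planeForm H D (Z (fderiv ℝ F u₀ v)) := by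
  set L := fderiv ℝ F u₀ with hL
  set f₁ := L (coordVec 0) with hf₁
  set f₂ := L (coordVec 1) with hf₂
  set N := cross f₁ f₂ with hN
  have hLv : ∀ v : E2, L v = v 0 • f₁ + v 1 • f₂ := fun v => by
    conv_lhs => rw [E2.eq_coords v]
    rw [map_add, map_smul, map_smul]
  have hf₁0 : f₁ ≠ 0 := by
    intro h
    have := hinj (h.trans (map_zero L).symm)
    simpa [coordVec] using congrArg (fun v : E2 => v 0) this
  set f := ‖f₁‖ with hf
  have hfpos : 0 < f := norm_pos_iff.2 hf₁0
  have hf11 : inner ℝ f₁ f₁ = f ^ 2 := real_inner_self_eq_norm_sq f₁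
  have hN0 : N ≠ 0 := by
    intro h
    have h1 : inner ℝ N N = (0 : ℝ) := by rw [h, inner_zero_left]
    rw [hN, inner_cross_cross] at h1
    -- L w is −‖f₁‖² times the component of f₂ orthogonal to f₁, and its squared length is ‖f₁‖²
    -- times the Gram determinant, assumed to vanish here.
    set w : E2 := (inner ℝ f₁ f₂ : ℝ) • coordVec 0 - (inner ℝ f₁ f₁ : ℝ) • coordVec 1 with hw
    have h2 : L w = 0 := by
      rw [← inner_self_eq_zero (𝕜 := ℝ), hw, map_sub, map_smul, map_smul, ← hf₁, ← hf₂]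
      simp only [inner_sub_left, inner_sub_right, inner_smul_left, inner_smul_right,
        real_inner_comm f₁ f₂, conj_trivial] at h1 ⊢
      linear_combination (inner ℝ f₁ f₁ : ℝ) * h1
    have h3 := hinj (h2.trans (map_zero L).symm)
    have h4 : -(inner ℝ f₁ f₁ : ℝ) = 0 := by
      simpa [hw, coordVec, -inner_self_eq_norm_sq_to_K] using congrArg (fun v : E2 => v 1) h3
    rw [hf11] at h4
    nlinarith
  set ν := unitNormal F u₀ with hν
  have hνdef : ν = ‖N‖⁻¹ • N := rfl
  have hNpos : 0 < ‖N‖ := norm_pos_iff.2 hN0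
  have hνν : inner ℝ ν ν = (1 : ℝ) := by
    rw [hνdef, inner_smul_left, inner_smul_right, real_inner_self_eq_norm_sq, conj_trivial]
    field_simp
  have hf₁ν : inner ℝ f₁ ν = 0 := by
    rw [hνdef, inner_smul_right, inner_cross_left, mul_zero]
  have hf₂ν : inner ℝ f₂ ν = 0 := by
    rw [hνdef, inner_smul_right, inner_cross_right, mul_zero]
  set e := f⁻¹ • f₁ with he
  have hee : inner ℝ e e = 1 := by
    rw [he, inner_smul_left, inner_smul_right, hf11, conj_trivial]
    field_simp
  have hνe : inner ℝ ν e = 0 := by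
    rw [he, inner_smul_right, real_inner_comm, hf₁ν, mul_zero]
  have hLν : ∀ v, inner ℝ (L v) ν = 0 := fun v => by
    rw [hLv, inner_add_left, inner_smul_left, inner_smul_left, hf₁ν, hf₂ν]; simp
  set Z := planeCoord ν e with hZ
  have hZin := inner_eq_planeCoord hνν hee hνe
  have hZcr := inner_cross_eq_planeCoord hee hνe
  rw [← hZ] at hZin hZcr
  have hZ1re : (Z f₁).re = f := by
    rw [hZ, planeCoord_re, he, inner_smul_left, hf11, conj_trivial]
    field_simp
  have hZ1im : (Z f₁).im = 0 := by
    rw [hZ, planeCoord_im, he, inner_cross_cyclic]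
    have : cross (f⁻¹ • f₁) f₁ = 0 := by
      ext i
      fin_cases i <;> simp [cross_apply_zero, cross_apply_one, cross_apply_two] <;> ring
    rw [this, inner_zero_right]
  set g := (Z f₂).re with hg
  set h := (Z f₂).im with hh
  -- The frame starts along f₁, so Z ∘ L is upper triangular with diagonal f, h, and its determinant
  -- is the area of the parallelogram.
  have hhf : f * h = ‖N‖ := by
    have h1 := hZcr f₁ f₂
    rw [← hN, hνdef, inner_smul_right, real_inner_self_eq_norm_sq] at h1
    have h2 : ‖N‖⁻¹ * ‖N‖ ^ 2 = ‖N‖ := by field_simp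
    rw [h2] at h1
    simp [hZ1re, hZ1im] at h1
    exact h1.symm
  have hh0 : h ≠ 0 := by
    rintro h0
    rw [h0, mul_zero] at hhf
    exact hNpos.ne hhf
  have hf0 : f ≠ 0 := hfpos.ne'
  have hZL : ∀ v : E2, Z (L v) = ⟨v 0 * f + v 1 * g, v 1 * h⟩ := fun v => by
    rw [hLv, map_add, map_smul, map_smul]
    apply Complex.ext
    · simp [hZ1re, hg]
    · simp [hZ1im, hh]
  -- first fundamental form
  have hI : ∀ v w : E2, firstForm F u₀ v w =
      (v 0 * f + v 1 * g) * (w 0 * f + w 1 * g) + (v 1 * h) * (w 1 * h) := fun v w => by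
    rw [firstForm, ← hL, hZin, hLν, hZL, hZL]
    simp
  -- second fundamental form
  set A := fderiv ℝ (fderiv ℝ F) u₀ with hA
  have hsymm : ∀ v w, A v w = A w v := fun v w => (hF.isSymmSndFDerivAt (by simp)).eq v w
  set p := secondForm F u₀ (coordVec 0) (coordVec 0) with hp
  set q := secondForm F u₀ (coordVec 0) (coordVec 1) with hq
  set r := secondForm F u₀ (coordVec 1) (coordVec 1) with hr
  have hII : ∀ v w : E2, secondForm F u₀ v w =
      p * (v 0 * w 0) + q * (v 0 * w 1 + v 1 * w 0) + r * (v 1 * w 1) := fun v w => by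
    have hq' : inner ℝ (A (coordVec 1) (coordVec 0)) ν = q := by
      rw [hsymm]; rfl
    have hp' : inner ℝ (A (coordVec 0) (coordVec 0)) ν = p := rfl
    have hr' : inner ℝ (A (coordVec 1) (coordVec 1)) ν = r := rfl
    have hq'' : inner ℝ (A (coordVec 0) (coordVec 1)) ν = q := rfl
    rw [secondForm, ← hA, ← hν]
    conv_lhs => rw [E2.eq_coords v, E2.eq_coords w]
    simp only [map_add, map_smul, add_apply, smul_apply, inner_add_left, inner_smul_left,
      smul_add, hp', hq', hr', hq'', conj_trivial]
    ring
  -- a, b, c are the entries of the second fundamental form in the orthonormal frame, obtained by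
  -- solving the triangular change of basis.
  obtain ⟨a, b, c, ha, hb, hc⟩ : ∃ a b c : ℝ, p = a * f ^ 2 ∧ q = a * (f * g) + b * (f * h) ∧
      r = a * g ^ 2 + 2 * b * (g * h) + c * h ^ 2 := by
    refine ⟨p / f ^ 2, (q - p / f ^ 2 * (f * g)) / (f * h),
      (r - p / f ^ 2 * g ^ 2 - 2 * ((q - p / f ^ 2 * (f * g)) / (f * h)) * (g * h)) / h ^ 2,
      ?_, ?_, ?_⟩ <;> field_simp <;> ring
  have hII' : ∀ v w : E2, secondForm F u₀ v w =
      a * ((v 0 * f + v 1 * g) * (w 0 * f + w 1 * g)) +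
      b * ((v 0 * f + v 1 * g) * (w 1 * h) + (v 1 * h) * (w 0 * f + w 1 * g)) +
      c * ((v 1 * h) * (w 1 * h)) := fun v w => by
    rw [hII, ha, hb, hc]; ring
  -- eigenvectors in the orthonormal frame are principal directions
  have hprin : ∀ x y k : ℝ, (x ≠ 0 ∨ y ≠ 0) → a * x + b * y = k * x → b * x + c * y = k * y →
      IsPrincipalCurvature F u₀ k := by
    intro x y k hxy h1 h2
    refine ⟨((x - y / h * g) / f) • coordVec 0 + (y / h) • coordVec 1, ?_, fun w => ?_⟩
    · intro h0
      have e0 : (x - y / h * g) / f = 0 := by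
        simpa [coordVec] using congrArg (fun v : E2 => v 0) h0
      have e1 : y / h = 0 := by
        simpa [coordVec] using congrArg (fun v : E2 => v 1) h0
      rw [e1] at e0
      have hy : y = 0 := by simpa [hh0] using e1
      have hx : x = 0 := by simpa [hf0] using e0
      exact hxy.elim (· hx) (· hy)
    · rw [hII', hI]
      have c0 : (((x - y / h * g) / f) • coordVec 0 + (y / h) • coordVec 1 : E2) 0 =
          (x - y / h * g) / f := by simp [coordVec]
      have c1 : (((x - y / h * g) / f) • coordVec 0 + (y / h) • coordVec 1 : E2) 1 =
          y / h := by simp [coordVec]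
      rw [c0, c1]
      have hx' : (x - y / h * g) / f * f + y / h * g = x := by field_simp; ring
      have hy' : y / h * h = y := by field_simp
      rw [hx', hy']
      linear_combination (w 0 * f + w 1 * g) * h1 + (w 1 * h) * h2
  -- Half trace and traceless part of the symmetric matrix (a, b; b, c), with signs as in
  -- `planeForm_eq`; then H² − ‖D‖² = ac − b².
  refine ⟨Z, (a + c) / 2, ⟨(a - c) / 2, -b⟩, hνν, hZin, hZcr, hLν, ?_, ?_, ?_⟩
  · rw [gaussianCurvature, hI, hI, hI, Complex.sq_norm, Complex.normSq_apply, ← hp, ← hq, ← hr]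
    have e00 : (coordVec 0 : E2) 0 = 1 := by simp [coordVec]
    have e01 : (coordVec 0 : E2) 1 = 0 := by simp [coordVec]
    have e10 : (coordVec 1 : E2) 0 = 0 := by simp [coordVec]
    have e11 : (coordVec 1 : E2) 1 = 1 := by simp [coordVec]
    rw [e00, e01, e10, e11, ha, hb, hc]
    have : (1 * f + 0 * g) * (1 * f + 0 * g) + 0 * h * (0 * h) ≠ 0 := by
      simpa using hf0
    rw [div_eq_iff]
    · ring
    · have h1 : ((1 * f + 0 * g) * (1 * f + 0 * g) + 0 * h * (0 * h)) *
          ((0 * f + 1 * g) * (0 * f + 1 * g) + 1 * h * (1 * h)) -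
          ((1 * f + 0 * g) * (0 * f + 1 * g) + 0 * h * (1 * h)) ^ 2 = (f * h) ^ 2 := by ring
      rw [h1]
      exact pow_ne_zero 2 (mul_ne_zero hf0 hh0)
  · intro humb
    by_cases hb0 : b = 0
    · have h1 := humb a c (hprin 1 0 a (Or.inl one_ne_zero) (by ring) (by rw [hb0]; ring))
        (hprin 0 1 c (Or.inr one_ne_zero) (by rw [hb0]; ring) (by ring))
      apply Complex.ext <;> simp [h1, hb0]
    · exfalso
      -- The eigenvalues are (a + c)/2 ± d, with eigenvectors (b, k − a); for b ≠ 0 they are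
      -- distinct, against umbilicity.
      set d := Real.sqrt (((a - c) / 2) ^ 2 + b ^ 2) with hd
      have hpos : 0 < ((a - c) / 2) ^ 2 + b ^ 2 := by positivity
      have hd2 : d ^ 2 = ((a - c) / 2) ^ 2 + b ^ 2 := Real.sq_sqrt hpos.le
      have hd0 : 0 < d := Real.sqrt_pos.2 hpos
      have h1 := humb ((a + c) / 2 + d) ((a + c) / 2 - d)
        (hprin b ((a + c) / 2 + d - a) _ (Or.inl hb0) (by ring) (by linear_combination -hd2))
        (hprin b ((a + c) / 2 - d - a) _ (Or.inl hb0) (by ring) (by linear_combination -hd2))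
      linarith
  · intro v
    rw [hII', planeForm_eq, hZL]
    ring

/-- Both terms are differences of squares, hence factor. This allows replacing the linearized
displacement by the true one inside the quadratic form. -/
theorem abs_planeForm_sub_le (H : ℝ) (D z w : ℂ) :
    |planeForm H D z - planeForm H D w| ≤ (|H| + ‖D‖) * (‖z - w‖ * (‖z‖ + ‖w‖)) := by
  have h1 : planeForm H D z - planeForm H D w =
      H * ((‖z‖ - ‖w‖) * (‖z‖ + ‖w‖)) + (D * ((z - w) * (z + w))).re := by
    simp only [planeForm]
    have : D * ((z - w) * (z + w)) = D * z ^ 2 - D * w ^ 2 := by ring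
    rw [this, Complex.sub_re]
    ring
  have h2 : |(D * ((z - w) * (z + w))).re| ≤ ‖D‖ * (‖z - w‖ * (‖z‖ + ‖w‖)) := by
    refine (Complex.abs_re_le_norm _).trans ?_
    rw [norm_mul, norm_mul]
    gcongr
    exact norm_add_le _ _
  have h3 : |H * ((‖z‖ - ‖w‖) * (‖z‖ + ‖w‖))| ≤ |H| * (‖z - w‖ * (‖z‖ + ‖w‖)) := by
    rw [abs_mul, abs_mul, abs_of_nonneg (by positivity : 0 ≤ ‖z‖ + ‖w‖)]
    gcongr
    exact abs_norm_sub_norm_le z w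
  rw [h1]
  refine (abs_add_le _ _).trans ?_
  linarith

/-- The height over the tangent plane agrees to second order with half the second fundamental
form of the tangential part. -/
theorem height_sub_planeForm_isLittleO {F : E2 → E3} {u₀ : E2} (hF : ContDiffAt ℝ 2 F u₀)
    (hinj : Function.Injective (fderiv ℝ F u₀)) {Z : E3 →L[ℝ] ℂ} {H : ℝ} {D : ℂ}
    (hν : ∀ v, inner ℝ (fderiv ℝ F u₀ v) (unitNormal F u₀) = 0)
    (hII : ∀ v, secondForm F u₀ v v = planeForm H D (Z (fderiv ℝ F u₀ v))) :
    (fun u => inner ℝ (F u - F u₀) (unitNormal F u₀) - planeForm H D (Z (F u - F u₀)) / 2)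
      =o[𝓝 u₀] fun u => ‖F u - F u₀‖ ^ 2 := by
  set L := fderiv ℝ F u₀ with hL
  set ν := unitNormal F u₀
  have hd : HasFDerivAt F L u₀ := (hF.differentiableAt (by norm_num)).hasFDerivAt
  -- Immersivity bounds ‖u − u₀‖ by a multiple of ‖F u − F u₀‖, so errors measured in the parameter
  -- may be measured in space.
  obtain ⟨K, -, hK⟩ := L.exists_antilipschitzWith (LinearMap.ker_eq_bot.2 hinj)
  have hrev : (fun u => u - u₀) =O[𝓝 u₀] fun u => F u - F u₀ := 
    (hd.isTheta_sub (hK.isInducing L.continuous)).2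
  have hrev2 : (fun u => ‖u - u₀‖ ^ 2) =O[𝓝 u₀] fun u => ‖F u - F u₀‖ ^ 2 :=
    hrev.norm_norm.pow 2
  refine Asymptotics.IsLittleO.trans_isBigO ?_ hrev2
  have hT := hF.taylor_two_isLittleO
  have hTν : (fun u => inner ℝ (F u - F u₀ - L (u - u₀)
      - (2⁻¹ : ℝ) • fderiv ℝ (fderiv ℝ F) u₀ (u - u₀) (u - u₀)) ν)
      =o[𝓝 u₀] fun u => ‖u - u₀‖ ^ 2 := by
    refine Asymptotics.IsBigO.trans_isLittleO ?_ hT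
    refine Asymptotics.IsBigO.of_bound ‖ν‖ (Eventually.of_forall fun u => ?_)
    rw [mul_comm]
    exact norm_inner_le_norm _ _
  have hZo : (fun u => Z (F u - F u₀) - Z (L (u - u₀))) =o[𝓝 u₀] fun u => ‖u - u₀‖ := by
    have h1 : (fun u => Z (F u - F u₀ - L (u - u₀))) =o[𝓝 u₀] fun u => u - u₀ :=
      (Z.isBigO_comp _ _).trans_isLittleO hd.isLittleO
    simpa only [map_sub] using h1.norm_right
  have hZ1 : (fun u => Z (F u - F u₀)) =O[𝓝 u₀] fun u => ‖u - u₀‖ :=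
    ((Z.isBigO_comp _ _).trans hd.isBigO_sub).norm_right
  have hZ2 : (fun u => Z (L (u - u₀))) =O[𝓝 u₀] fun u => ‖u - u₀‖ :=
    ((Z.isBigO_comp _ _).trans (L.isBigO_comp _ _)).norm_right
  have hQ : (fun u => planeForm H D (Z (L (u - u₀))) - planeForm H D (Z (F u - F u₀)))
      =o[𝓝 u₀] fun u => ‖u - u₀‖ ^ 2 := by
    have h1 : (fun u => ‖Z (F u - F u₀) - Z (L (u - u₀))‖ *
        (‖Z (L (u - u₀))‖ + ‖Z (F u - F u₀)‖)) =o[𝓝 u₀] fun u => ‖u - u₀‖ ^ 2 := by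
      simpa only [pow_two] using hZo.norm_left.mul_isBigO (hZ2.norm_left.add hZ1.norm_left)
    refine Asymptotics.IsBigO.trans_isLittleO ?_ h1
    refine Asymptotics.IsBigO.of_bound (|H| + ‖D‖) (Eventually.of_forall fun u => ?_)
    rw [Real.norm_eq_abs, Real.norm_of_nonneg (by positivity), norm_sub_rev]
    exact abs_planeForm_sub_le _ _ _ _
  -- The linear Taylor term is tangent and drops out; `hQ` corrects the argument of the quadratic
  -- one.
  refine (hTν.add (hQ.const_mul_left 2⁻¹)).congr_left fun u => ?_
  have h2 : inner ℝ (fderiv ℝ (fderiv ℝ F) u₀ (u - u₀) (u - u₀)) ν =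
    planeForm H D (Z (L (u - u₀))) := hII (u - u₀)
  rw [inner_sub_left, inner_sub_left (F u - F u₀), inner_smul_left, hν, h2, conj_trivial]
  ring

/-- A tangential coordinate system at a point of an embedded surface: complex coordinate `Z` in
the tangent plane, half mean curvature sum `H`, and traceless part `D` of the second fundamental
form. -/
theorem IsLocalParametrization.exists_tangent_coord {S : Set E3} {U : Set E2} {F : E2 → E3}
    {u₀ : E2} (hF : IsLocalParametrization S U F u₀) :
    ∃ (Z : E3 →L[ℝ] ℂ) (H : ℝ) (D : ℂ),
      inner ℝ (unitNormal F u₀) (unitNormal F u₀) = (1 : ℝ) ∧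
      (∀ x y, inner ℝ x y = (starRingEnd ℂ (Z x) * Z y).re +
        inner ℝ x (unitNormal F u₀) * inner ℝ y (unitNormal F u₀)) ∧
      (∀ x y, inner ℝ (cross x y) (unitNormal F u₀) = (starRingEnd ℂ (Z x) * Z y).im) ∧
      gaussianCurvature F u₀ = H ^ 2 - ‖D‖ ^ 2 ∧
      (IsUmbilical F u₀ → D = 0) ∧
      ∀ ε > 0, ∃ r > 0, ∀ x ∈ S, dist (F u₀) x < r →
        |inner ℝ (x - F u₀) (unitNormal F u₀) - planeForm H D (Z (x - F u₀)) / 2| ≤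
          ε * ‖x - F u₀‖ ^ 2 := by
  have hC : ContDiffAt ℝ 2 F u₀ := hF.contDiffOn.contDiffAt (hF.isOpen.mem_nhds hF.mem)
  have hinj := hF.immersion u₀ hF.mem
  obtain ⟨Z, H, D, h1, h2, h3, h4, h5, h6, h7⟩ := _root_.exists_tangent_coord hC hinj
  refine ⟨Z, H, D, h1, h2, h3, h5, h6, fun ε hε => ?_⟩
  have h8 := (Asymptotics.isLittleO_iff.1 (height_sub_planeForm_isLittleO hC hinj h4 h7)) hε
  obtain ⟨r, hr, h9⟩ := hF.exists_param_of_dist_lt h8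
  refine ⟨r, hr, fun x hx hxr => ?_⟩
  obtain ⟨u, hu, rfl⟩ := h9 x hx hxr
  simpa using hu

/-! ### Angles of nearly horizontal triangles -/

/-- Angles are controlled by their cosines, away from degenerate angles. -/
theorem abs_sub_mul_sin_le_of_cos {β γ : ℝ} (hβ : β ∈ Set.Icc 0 Real.pi)
    (hγ : γ ∈ Set.Icc 0 Real.pi) :
    |β - γ| * Real.sin γ ≤ Real.pi * |Real.cos β - Real.cos γ| := by
  obtain ⟨hβ0, hβ1⟩ := hβ
  obtain ⟨hγ0, hγ1⟩ := hγ
  have hπ := Real.pi_pos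
  have hsβ : 0 ≤ Real.sin (β / 2) := Real.sin_nonneg_of_nonneg_of_le_pi (by linarith) (by linarith)
  have hsγ : 0 ≤ Real.sin (γ / 2) := Real.sin_nonneg_of_nonneg_of_le_pi (by linarith) (by linarith)
  have hcβ : 0 ≤ Real.cos (β / 2) :=
    Real.cos_nonneg_of_neg_pi_div_two_le_of_le (by linarith) (by linarith)
  have hcγ : 0 ≤ Real.cos (γ / 2) :=
    Real.cos_nonneg_of_neg_pi_div_two_le_of_le (by linarith) (by linarith)
  -- Keeps the first factor of cos β − cos γ = −2 sin((β+γ)/2) sin((β−γ)/2) away from zero. It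
  -- follows from sin(β/2) + cos(β/2) ≥ 1.
  have hsum : Real.sin γ / 2 ≤ Real.sin ((β + γ) / 2) := by
    have h1 : Real.sin γ = 2 * Real.sin (γ / 2) * Real.cos (γ / 2) := by
      rw [← Real.sin_two_mul]; ring_nf
    have h2 : Real.sin ((β + γ) / 2) = Real.sin (β / 2) * Real.cos (γ / 2) +
        Real.cos (β / 2) * Real.sin (γ / 2) := by
      rw [← Real.sin_add]; ring_nf
    have h3 : 1 ≤ Real.sin (β / 2) + Real.cos (β / 2) := by
      nlinarith [Real.sin_sq_add_cos_sq (β / 2), mul_nonneg hsβ hcβ]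
    have h4 := Real.sin_le_one (γ / 2)
    have h5 := Real.cos_le_one (γ / 2)
    rw [h1, h2]
    nlinarith [mul_nonneg hsγ hcγ, mul_nonneg (mul_nonneg hsβ hcγ) (sub_nonneg.2 h4),
      mul_nonneg (mul_nonneg hcβ hsγ) (sub_nonneg.2 h5),
      mul_nonneg (mul_nonneg hsγ hcγ) (sub_nonneg.2 h3)]
  have hdiff : |β - γ| / Real.pi ≤ |Real.sin ((β - γ) / 2)| := by
    have h1 : |(β - γ) / 2| ≤ Real.pi / 2 := by
      rw [abs_le]; constructor <;> linarith
    have h2 := Real.mul_abs_le_abs_sin h1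
    rw [abs_div, abs_two] at h2
    calc |β - γ| / Real.pi = 2 / Real.pi * (|β - γ| / 2) := by ring
      _ ≤ _ := h2
  have hsγ0 : 0 ≤ Real.sin γ := Real.sin_nonneg_of_nonneg_of_le_pi hγ0 hγ1
  rw [Real.cos_sub_cos, abs_mul, abs_mul, abs_neg, abs_two,
    abs_of_nonneg ((div_nonneg hsγ0 two_pos.le).trans hsum)]
  have h6 : |β - γ| = Real.pi * (|β - γ| / Real.pi) := by field_simp
  calc |β - γ| * Real.sin γ = Real.pi * (2 * (Real.sin γ / 2) * (|β - γ| / Real.pi)) := by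
        rw [h6]; field_simp
    _ ≤ _ := by
        have h7 : 0 ≤ 2 * Real.sin ((β + γ) / 2) := by linarith
        gcongr

/-- First-order Taylor expansion of the cosine at γ, with a remainder valid for all real angles; it
converts the cosine law into a formula for β − γ. -/
theorem abs_cos_sub_cos_sub_le (β γ : ℝ) :
    |(Real.cos γ - Real.cos β) - (β - γ) * Real.sin γ| ≤ (β - γ) ^ 2 := by
  set d := β - γ with hd
  have hβ : β = γ + d := by rw [hd]; ring
  have h1 : (Real.cos γ - Real.cos β) - d * Real.sin γ =
      Real.cos γ * (1 - Real.cos d) + Real.sin γ * (Real.sin d - d) := by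
    rw [hβ, Real.cos_add]; ring
  have h2 : |1 - Real.cos d| ≤ d ^ 2 / 2 := by
    rw [abs_le]
    constructor
    · linarith [Real.cos_le_one d, sq_nonneg d]
    · linarith [Real.one_sub_sq_div_two_le_cos (x := d)]
  have h3 : |Real.sin d - d| ≤ d ^ 2 / 2 := by
    have key : ∀ x : ℝ, 0 ≤ x → |Real.sin x - x| ≤ x ^ 2 / 2 := by
      intro x hx
      rw [abs_sub_comm, abs_of_nonneg (sub_nonneg.2 (Real.sin_le hx))]
      -- Up to 3 the cubic bound for the sine is enough; beyond 3, x + 1 ≤ x² / 2.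
      rcases le_or_gt x 3 with hx3 | hx3
      · nlinarith [Real.sin_ge_sub_cube hx, mul_nonneg (sq_nonneg x) (sub_nonneg.2 hx3)]
      · nlinarith [Real.neg_one_le_sin x]
    rcases le_total 0 d with hd0 | hd0
    · exact key d hd0
    · have h4 := key (-d) (by linarith)
      rwa [Real.sin_neg, neg_sub_neg, abs_sub_comm, neg_sq] at h4
  rw [h1]
  refine (abs_add_le _ _).trans ?_
  rw [abs_mul, abs_mul]
  have h4 := Real.abs_cos_le_one γ
  have h5 := Real.abs_sin_le_one γ
  have h6 : |Real.cos γ| * |1 - Real.cos d| ≤ 1 * (d ^ 2 / 2) := by gcongr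
  have h7 : |Real.sin γ| * |Real.sin d - d| ≤ 1 * (d ^ 2 / 2) := by gcongr
  linarith

/-- The difference between the angle `β` of the projections of two directions and the angle `γ`
of the directions themselves; `s, s'` are the sines of the elevations. -/
theorem angle_defect_bound {c β γ s s' : ℝ} (hc : 0 < c) (hβ : β ∈ Set.Icc 0 Real.pi)
    (hγ : γ ∈ Set.Icc 0 Real.pi) (hsin : c ≤ Real.sin γ) (hs : s ^ 2 ≤ 1) (hs' : s' ^ 2 ≤ 1)
    (hcos : Real.cos γ = √(1 - s ^ 2) * √(1 - s' ^ 2) * Real.cos β + s * s') :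
    |β - γ| ≤ 2 * Real.pi / c * (s ^ 2 + s' ^ 2) ∧
    |(β - γ) - (s * s' - Real.cos γ / 2 * (s ^ 2 + s' ^ 2)) / Real.sin γ| ≤
      ((2 * Real.pi / c) ^ 2 + 3) / c * (s ^ 2 + s' ^ 2) ^ 2 := by
  set m := √(1 - s ^ 2) * √(1 - s' ^ 2) with hm
  set ρ := s ^ 2 + s' ^ 2 with hρ
  have hρ0 : 0 ≤ ρ := by positivity
  have hm0 : 0 ≤ m := by positivity
  have hm2 : m ^ 2 = (1 - s ^ 2) * (1 - s' ^ 2) := by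
    rw [hm, mul_pow, Real.sq_sqrt (by linarith), Real.sq_sqrt (by linarith)]
  have hm1 : m ≤ 1 := by nlinarith [sq_nonneg s, sq_nonneg s']
  have hmρ : 1 - m ≤ ρ := by nlinarith [mul_nonneg (sq_nonneg s) (sq_nonneg s')]
  have hss : |s * s'| ≤ ρ / 2 := by
    rw [abs_le]; constructor <;> nlinarith [sq_nonneg (s + s'), sq_nonneg (s - s')]
  have hcβ := Real.abs_cos_le_one β
  have hcγ := Real.abs_cos_le_one γ
  have hdc : |Real.cos β - Real.cos γ| ≤ 2 * ρ := by
    have h1 : Real.cos β - Real.cos γ = (1 - m) * Real.cos β - s * s' := by rw [hcos]; ring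
    rw [h1]
    refine (abs_sub _ _).trans ?_
    rw [abs_mul, abs_of_nonneg (sub_nonneg.2 hm1)]
    have h2 : (1 - m) * |Real.cos β| ≤ ρ * 1 := by gcongr
    linarith
  have hsγ : 0 < Real.sin γ := hc.trans_le hsin
  have hd : |β - γ| ≤ 2 * Real.pi / c * ρ := by
    have h1 := abs_sub_mul_sin_le_of_cos hβ hγ
    have h2 : |β - γ| * c ≤ Real.pi * (2 * ρ) :=
      calc |β - γ| * c ≤ |β - γ| * Real.sin γ := by gcongr
        _ ≤ _ := h1
        _ ≤ _ := by gcongr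
    rw [← le_div_iff₀ hc] at h2
    refine h2.trans_eq (by ring)
  refine ⟨hd, ?_⟩
  have h1 := abs_cos_sub_cos_sub_le β γ
  have h2 : (β - γ) ^ 2 ≤ (2 * Real.pi / c) ^ 2 * ρ ^ 2 := by
    rw [← sq_abs, ← mul_pow]
    gcongr
  -- From m² = 1 − ρ + (s s')², completing the square expresses 1 − m − ρ/2 exactly through (1 − m)²
  -- and (s s')².
  have hm4 : |(1 - m) - ρ / 2| ≤ ρ ^ 2 := by
    have h3 : (1 - m) - ρ / 2 = (1 - m) ^ 2 / 2 - (s * s') ^ 2 / 2 := by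
      have : (1 - m) ^ 2 = 1 - 2 * m + (1 - s ^ 2) * (1 - s' ^ 2) := by rw [← hm2]; ring
      rw [this, hρ]; ring
    have h4 : (1 - m) ^ 2 ≤ ρ ^ 2 := by
      have := sub_nonneg.2 hm1
      gcongr
    have h5 : (s * s') ^ 2 ≤ ρ ^ 2 := by
      rw [← sq_abs (s * s')]
      have : |s * s'| ≤ ρ := by linarith
      gcongr
    rw [h3, abs_le]
    constructor <;> nlinarith [sq_nonneg (1 - m), sq_nonneg (s * s')]
  -- Three errors are collected: the Taylor remainder of the cosine, 1 − m replaced by ρ/2 (at most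
  -- ρ²), and cos β replaced by cos γ (at most 2ρ²). The last two make up the constant 3.
  have h5 : |(β - γ) * Real.sin γ - (s * s' - Real.cos γ / 2 * ρ)| ≤
      ((2 * Real.pi / c) ^ 2 + 3) * ρ ^ 2 := by
    have h6 : (β - γ) * Real.sin γ - (s * s' - Real.cos γ / 2 * ρ) =
        -((Real.cos γ - Real.cos β) - (β - γ) * Real.sin γ) -
          Real.cos γ * ((1 - m) - ρ / 2) - (1 - m) * (Real.cos β - Real.cos γ) := by
      linear_combination hcos
    rw [h6]
    refine (abs_sub _ _).trans ?_
    refine (add_le_add_left (abs_sub _ _) _).trans ?_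
    rw [abs_neg, abs_mul, abs_mul, abs_of_nonneg (sub_nonneg.2 hm1)]
    have h7 : |Real.cos γ| * |(1 - m) - ρ / 2| ≤ 1 * ρ ^ 2 := by gcongr
    have h8 : (1 - m) * |Real.cos β - Real.cos γ| ≤ ρ * (2 * ρ) := by gcongr
    nlinarith
  have h6 : (β - γ) - (s * s' - Real.cos γ / 2 * ρ) / Real.sin γ =
      ((β - γ) * Real.sin γ - (s * s' - Real.cos γ / 2 * ρ)) / Real.sin γ := by
    field_simp
  rw [h6, abs_div, abs_of_pos hsγ, div_le_iff₀ hsγ]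
  refine h5.trans ?_
  calc ((2 * Real.pi / c) ^ 2 + 3) * ρ ^ 2 = ((2 * Real.pi / c) ^ 2 + 3) / c * ρ ^ 2 * c := by
        field_simp
    _ ≤ _ := by gcongr

/-- The tangential part of the area gradient of a nearly horizontal triangle is, to second order,
the rotated projection of the opposite edge. -/
theorem area_gradient_bound {c C σ η η' s s' q : ℝ} {a b : ℂ} (hc : 0 < c) (hc1 : c ≤ 1)
    (hη : 0 ≤ η) (hη' : 0 ≤ η') (hq : c ≤ q) (hqC : q ^ 2 + C ^ 2 = 1)
    (ha : ‖a‖ ^ 2 + s ^ 2 = 1) (hb : ‖b‖ ^ 2 + s' ^ 2 = 1)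
    (hC : C = (starRingEnd ℂ a * b).re + s * s') (hσ : σ ^ 2 = 1)
    (hX : 0 ≤ σ * (starRingEnd ℂ a * b).im) :
    ‖((η' - η * C) / q) • a + ((η - η' * C) / q) • b -
        (σ * Complex.I) * (η * a - η' * b)‖ ≤ 4 / c ^ 2 * (η + η') * (s ^ 2 + s' ^ 2) := by
  set R := (starRingEnd ℂ a * b).re with hR
  set X := (starRingEnd ℂ a * b).im with hXdef
  set ρ := s ^ 2 + s' ^ 2 with hρ
  have hq0 : 0 < q := hc.trans_le hq
  have hna : ‖a‖ ≤ 1 := by nlinarith [norm_nonneg a]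
  have hnb : ‖b‖ ≤ 1 := by nlinarith [norm_nonneg b]
  have haa : a.re * a.re + a.im * a.im + s ^ 2 = 1 := by
    rw [← ha, Complex.sq_norm, Complex.normSq_apply]
  have hbb : b.re * b.re + b.im * b.im + s' ^ 2 = 1 := by
    rw [← hb, Complex.sq_norm, Complex.normSq_apply]
  have hR' : R = a.re * b.re + a.im * b.im := by simp [hR]
  have hX' : X = a.re * b.im - a.im * b.re := by simp [hXdef]; ring
  have hRX : R ^ 2 + X ^ 2 = (1 - s ^ 2) * (1 - s' ^ 2) := by
    have h1 : 1 - s ^ 2 = a.re * a.re + a.im * a.im := by linarith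
    have h2 : 1 - s' ^ 2 = b.re * b.re + b.im * b.im := by linarith
    rw [h1, h2, hR', hX']; ring
  have hρ0 : 0 ≤ ρ := by positivity
  have hss : |s * s'| ≤ ρ / 2 := by
    rw [abs_le]; constructor <;> nlinarith [sq_nonneg (s + s'), sq_nonneg (s - s')]
  have hC1 : |C| ≤ 1 := by
    rw [← sq_le_one_iff_abs_le_one]; nlinarith
  -- q is the sine of the spatial angle and σX its planar counterpart. The difference of their
  -- squares is of order ρ, and orientation makes σX ≥ 0, so that q + σX ≥ c can be divided out.
  have hqX : |q - σ * X| * c ≤ 2 * ρ := by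
    have h1 : (q - σ * X) * (q + σ * X) = ρ - 2 * C * (s * s') := by
      have : (q - σ * X) * (q + σ * X) = q ^ 2 - σ ^ 2 * X ^ 2 := by ring
      rw [this, hσ]
      have h2 : R = C - s * s' := by linarith
      rw [h2] at hRX
      linear_combination hqC - hRX
    have h2 : |ρ - 2 * C * (s * s')| ≤ 2 * ρ := by
      refine (abs_sub _ _).trans ?_
      rw [abs_mul, abs_mul, abs_two, abs_of_nonneg hρ0]
      have : |C| * |s * s'| ≤ 1 * (ρ / 2) := by gcongr
      linarith
    rw [← h1, abs_mul, abs_of_pos (by linarith : 0 < q + σ * X)] at h2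
    refine le_trans ?_ h2
    gcongr
    linarith
  set T := ((η' - η * C) / q) • a + ((η - η' * C) / q) • b -
        (σ * Complex.I) * (η * a - η' * b) with hT
  -- After clearing the denominator, the error comes only from q versus σX and from the elevations
  -- hidden in |a|², |b|² and C.
  have hqT : (q : ℂ) * T = -(((q - σ * X : ℝ) : ℂ) * (σ * Complex.I * (η * a - η' * b))) +
      (((η' * s' ^ 2 - η * (s * s') : ℝ) : ℂ) * a +
        ((η * s ^ 2 - η' * (s * s') : ℝ) : ℂ) * b) := by
    have h1 : (q : ℂ) * T = ((η' - η * C : ℝ) : ℂ) * a + ((η - η' * C : ℝ) : ℂ) * b -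
        q * ((σ * Complex.I) * (η * a - η' * b)) := by
      have hq' : (q : ℂ) ≠ 0 := by exact_mod_cast hq0.ne'
      rw [hT]
      simp only [Complex.real_smul]
      push_cast
      field_simp
    have hσ' : (σ : ℂ) ^ 2 = 1 := by exact_mod_cast hσ
    have ha' : starRingEnd ℂ a * a = ((1 - s ^ 2 : ℝ) : ℂ) := by
      rw [mul_comm, Complex.mul_conj, ← Complex.sq_norm]; congr 1; linarith
    have hb' : starRingEnd ℂ b * b = ((1 - s' ^ 2 : ℝ) : ℂ) := by
      rw [mul_comm, Complex.mul_conj, ← Complex.sq_norm]; congr 1; linarith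
    have hab : starRingEnd ℂ a * b = R + X * Complex.I := (Complex.re_add_im _).symm
    have hba : starRingEnd ℂ b * a = R - X * Complex.I := by
      have := congrArg (starRingEnd ℂ) hab
      simpa [mul_comm, sub_eq_add_neg] using this
    -- X·i·a is |a|² times the component of b orthogonal to a: this is where the quarter turn of the
    -- edge appears.
    have e1 : X * Complex.I * a = ((1 - s ^ 2 : ℝ) : ℂ) * b - R * a := by
      rw [← ha']; linear_combination -a * hab
    have e2 : X * Complex.I * b = R * b - ((1 - s' ^ 2 : ℝ) : ℂ) * a := by
      rw [← hb']; linear_combination b * hba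
    have hCc : (C : ℂ) = R + s * s' := by exact_mod_cast hC
    rw [h1]
    push_cast at e1 e2 ⊢
    rw [hCc]
    linear_combination (-η : ℂ) * e1 + (η' : ℂ) * e2 - X * Complex.I * (η * a - η' * b) * hσ'
  have hσ1 : |σ| = 1 := by
    rw [← sq_eq_sq₀ (abs_nonneg σ) zero_le_one, sq_abs, hσ, one_pow]
  have hnd : ‖(η : ℂ) * a - η' * b‖ ≤ η + η' := by
    refine (norm_sub_le _ _).trans ?_
    rw [norm_mul, norm_mul, Complex.norm_real, Complex.norm_real, Real.norm_of_nonneg hη,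
      Real.norm_of_nonneg hη']
    have h1 : η * ‖a‖ ≤ η * 1 := by gcongr
    have h2 : η' * ‖b‖ ≤ η' * 1 := by gcongr
    linarith
  have k1 : |η' * s' ^ 2 - η * (s * s')| ≤ (η + η') * ρ := by
    refine (abs_sub _ _).trans ?_
    rw [abs_mul, abs_mul, abs_of_nonneg hη, abs_of_nonneg hη', abs_of_nonneg (sq_nonneg s')]
    have h1 : η' * s' ^ 2 ≤ η' * ρ := by gcongr; linarith [sq_nonneg s]
    have h2 : η * |s * s'| ≤ η * ρ := by gcongr; linarith
    linarith
  have k2 : |η * s ^ 2 - η' * (s * s')| ≤ (η + η') * ρ := by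
    refine (abs_sub _ _).trans ?_
    rw [abs_mul, abs_mul, abs_of_nonneg hη, abs_of_nonneg hη', abs_of_nonneg (sq_nonneg s)]
    have h1 : η * s ^ 2 ≤ η * ρ := by gcongr; linarith [sq_nonneg s']
    have h2 : η' * |s * s'| ≤ η' * ρ := by gcongr; linarith
    linarith
  have hmain : q * ‖T‖ ≤ |q - σ * X| * (η + η') + 2 * ((η + η') * ρ) := by
    have h1 : q * ‖T‖ = ‖(q : ℂ) * T‖ := by
      rw [norm_mul, Complex.norm_real, Real.norm_of_nonneg hq0.le]
    rw [h1, hqT]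
    refine (norm_add_le _ _).trans (add_le_add ?_ ((norm_add_le _ _).trans ?_))
    · rw [norm_neg, norm_mul, norm_mul, norm_mul, Complex.norm_I, Complex.norm_real,
        Complex.norm_real, Real.norm_eq_abs, Real.norm_eq_abs, hσ1, one_mul, one_mul]
      gcongr
    · rw [norm_mul, norm_mul, Complex.norm_real, Complex.norm_real, Real.norm_eq_abs,
        Real.norm_eq_abs]
      have h2 : |η' * s' ^ 2 - η * (s * s')| * ‖a‖ ≤ (η + η') * ρ * 1 := by gcongr
      have h3 : |η * s ^ 2 - η' * (s * s')| * ‖b‖ ≤ (η + η') * ρ * 1 := by gcongr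
      linarith
  have hcT : c ^ 2 * ‖T‖ ≤ 4 * ((η + η') * ρ) := by
    calc c ^ 2 * ‖T‖ = c * (c * ‖T‖) := by ring
      _ ≤ c * (q * ‖T‖) := by gcongr
      _ ≤ c * (|q - σ * X| * (η + η') + 2 * ((η + η') * ρ)) := by gcongr
      _ = (|q - σ * X| * c) * (η + η') + c * (2 * ((η + η') * ρ)) := by ring
      _ ≤ (2 * ρ) * (η + η') + 1 * (2 * ((η + η') * ρ)) := by gcongr
      _ = 4 * ((η + η') * ρ) := by ring
  calc ‖T‖ = c ^ 2 * ‖T‖ / c ^ 2 := by field_simp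
    _ ≤ 4 * ((η + η') * ρ) / c ^ 2 := by gcongr
    _ = _ := by ring

/-! ### Cotangent weights of a one-ring -/

/-- 1, …, n is a complete residue system, namely `range n` shifted by one. Sums become cyclic, and
can be reindexed by i ↦ i + 1 at no cost. -/
theorem ZMod.sum_Icc_natCast {M : Type*} [AddCommMonoid M] {n : ℕ} [NeZero n] (f : ZMod n → M) :
    ∑ i ∈ Finset.Icc 1 n, f (i : ZMod n) = ∑ i, f i := by
  have h1 : ∀ g : ZMod n → M, ∑ i ∈ Finset.range n, g (i : ZMod n) = ∑ i, g i := fun g =>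
    Finset.sum_bij' (fun i _ => (i : ZMod n)) (fun i _ => i.val) (fun _ _ => Finset.mem_univ _)
      (fun i _ => Finset.mem_range.2 i.val_lt)
      (fun i hi => ZMod.val_cast_of_lt (Finset.mem_range.1 hi))
      (fun i _ => ZMod.natCast_zmod_val i) (fun _ _ => rfl)
  rw [← Finset.Ico_add_one_right_eq_Icc, Finset.sum_Ico_eq_sum_range]
  simp only [add_tsub_cancel_right]
  rw [← Equiv.sum_comp (Equiv.addLeft (1 : ZMod n)) f, ← h1]
  simp

/-- In the triangle 0, x, y the altitude from x has length ‖x‖ sin θ, and its foot lies at signed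
distance ‖y‖ − ‖x‖ cos θ from y. The sines are compared through the Gram determinant, the same seen
from 0 and from y. -/
theorem cot_angle_sub {x y : E3} (hx : x ≠ 0) (hy : y ≠ 0)
    (hs : 0 < Real.sin (InnerProductGeometry.angle x y)) :
    Real.cot (InnerProductGeometry.angle (x - y) (-y)) =
      (‖y‖ - ‖x‖ * Real.cos (InnerProductGeometry.angle x y)) /
        (‖x‖ * Real.sin (InnerProductGeometry.angle x y)) := by
  set θ := InnerProductGeometry.angle x y with hθ
  set ψ := InnerProductGeometry.angle (x - y) (-y) with hψ
  have hx0 : 0 < ‖x‖ := norm_pos_iff.2 hx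
  have hy0 : 0 < ‖y‖ := norm_pos_iff.2 hy
  have hc := InnerProductGeometry.cos_angle_mul_norm_mul_norm x y
  have hss := InnerProductGeometry.sin_angle_mul_norm_mul_norm x y
  have hc' := InnerProductGeometry.cos_angle_mul_norm_mul_norm (x - y) (-y)
  have hss' := InnerProductGeometry.sin_angle_mul_norm_mul_norm (x - y) (-y)
  rw [← hθ] at hc hss
  rw [← hψ] at hc' hss'
  have hgram : inner ℝ (x - y) (x - y) * inner ℝ (-y) (-y) -
      inner ℝ (x - y) (-y) * inner ℝ (x - y) (-y) =
      inner ℝ x x * inner ℝ y y - inner ℝ x y * inner ℝ x y := by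
    simp only [inner_sub_left, inner_sub_right, inner_neg_left, inner_neg_right,
      real_inner_comm x y]
    ring
  rw [hgram, ← hss] at hss'
  have hin : inner ℝ (x - y) (-y) = ‖y‖ ^ 2 - Real.cos θ * (‖x‖ * ‖y‖) := by
    rw [hc, inner_neg_right, inner_sub_left, real_inner_self_eq_norm_sq]; ring
  rw [hin] at hc'
  have hpos : 0 < Real.sin ψ * (‖x - y‖ * ‖-y‖) := by rw [hss']; positivity
  have hs0 : Real.sin ψ ≠ 0 := left_ne_zero_of_mul hpos.ne'
  rw [Real.cot_eq_cos_div_sin, div_eq_div_iff hs0 (by positivity)]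
  have hm : ‖x - y‖ * ‖-y‖ ≠ 0 := right_ne_zero_of_mul hpos.ne'
  apply mul_right_cancel₀ hm
  apply mul_right_cancel₀ hy0.ne'
  linear_combination (‖x‖ * Real.sin θ * ‖y‖) * hc' - ((‖y‖ - ‖x‖ * Real.cos θ) * ‖y‖) * hss'

section Weights

variable {n : ℕ} {p : E3} {P : ZMod n → E3}

theorem edgeLength_eq_norm (i : ZMod n) : edgeLength p P i = ‖P i - p‖ := by
  rw [edgeLength, dist_comm, dist_eq_norm]

theorem gammaAngle_eq (i : ZMod n) :
    gammaAngle p P i = InnerProductGeometry.angle (P i - p) (P (i + 1) - p) := rfl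

theorem gammaAngle_mem (i : ZMod n) : gammaAngle p P i ∈ Set.Icc 0 Real.pi :=
  ⟨InnerProductGeometry.angle_nonneg _ _, InnerProductGeometry.angle_le_pi _ _⟩

theorem cot_deltaAngle (h0 : ∀ i, P i ≠ p) (hs : ∀ i, 0 < Real.sin (gammaAngle p P i))
    (i : ZMod n) :
    Real.cot (deltaAngle p P i) =
      (edgeLength p P (i + 1) - edgeLength p P i * Real.cos (gammaAngle p P i)) /
        (edgeLength p P i * Real.sin (gammaAngle p P i)) := by
  have h1 : deltaAngle p P i = InnerProductGeometry.angle ((P i - p) - (P (i + 1) - p))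
      (-(P (i + 1) - p)) := by
    simp [deltaAngle, EuclideanGeometry.angle]
  rw [h1, edgeLength_eq_norm, edgeLength_eq_norm, gammaAngle_eq]
  exact cot_angle_sub (sub_ne_zero.2 (h0 _)) (sub_ne_zero.2 (h0 _)) (hs i)

/-- α_{i+1} and δ_i are the two outer angles of the same triangle p, p_i, p_{i+1}; this shift is
what permits grouping the weights by triangles. -/
theorem cot_alphaAngle_add_one (h0 : ∀ i, P i ≠ p)
    (hs : ∀ i, 0 < Real.sin (gammaAngle p P i)) (i : ZMod n) :
    Real.cot (alphaAngle p P (i + 1)) =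
      (edgeLength p P i - edgeLength p P (i + 1) * Real.cos (gammaAngle p P i)) /
        (edgeLength p P (i + 1) * Real.sin (gammaAngle p P i)) := by
  have h1 : alphaAngle p P (i + 1) = InnerProductGeometry.angle ((P (i + 1) - p) - (P i - p))
      (-(P i - p)) := by
    simp [alphaAngle, EuclideanGeometry.angle]
  rw [h1, edgeLength_eq_norm, edgeLength_eq_norm, gammaAngle_eq,
    InnerProductGeometry.angle_comm (P i - p)]
  refine cot_angle_sub (sub_ne_zero.2 (h0 _)) (sub_ne_zero.2 (h0 _)) ?_
  rw [InnerProductGeometry.angle_comm]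
  exact hs i

/-- Sums against the cotangent weights, rearranged triangle by triangle. -/
theorem sum_cotWeight_smul {M : Type*} [AddCommGroup M] [Module ℝ M] [NeZero n]
    (h0 : ∀ i, P i ≠ p) (hs : ∀ i, 0 < Real.sin (gammaAngle p P i)) (v : ZMod n → M) :
    ∑ i ∈ Finset.Icc 1 n, cotWeight p P (i : ZMod n) • v (i : ZMod n) =
      ∑ i : ZMod n,
        (((edgeLength p P (i + 1) - edgeLength p P i * Real.cos (gammaAngle p P i)) /
          Real.sin (gammaAngle p P i)) • ((edgeLength p P i)⁻¹ • v i) +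
        ((edgeLength p P i - edgeLength p P (i + 1) * Real.cos (gammaAngle p P i)) /
          Real.sin (gammaAngle p P i)) • ((edgeLength p P (i + 1))⁻¹ • v (i + 1))) := by
  rw [ZMod.sum_Icc_natCast (fun i => cotWeight p P i • v i)]
  simp only [cotWeight, add_smul, Finset.sum_add_distrib]
  rw [← Equiv.sum_comp (Equiv.addRight (1 : ZMod n)) fun i => Real.cot (alphaAngle p P i) • v i,
    add_comm]
  congr 1
  · refine Finset.sum_congr rfl fun i _ => ?_
    rw [cot_deltaAngle h0 hs, smul_smul]
    congr 1
    rw [mul_comm (edgeLength p P i) (Real.sin _), ← div_div, div_eq_mul_inv _ (edgeLength p P i)]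
  · refine Finset.sum_congr rfl fun i _ => ?_
    rw [Equiv.coe_addRight, cot_alphaAngle_add_one h0 hs, smul_smul]
    congr 1
    rw [mul_comm (edgeLength p P (i + 1)) (Real.sin _), ← div_div,
      div_eq_mul_inv _ (edgeLength p P (i + 1))]

theorem edgeLength_pos (h0 : ∀ i, P i ≠ p) (i : ZMod n) : 0 < edgeLength p P i := by
  rw [edgeLength_eq_norm]; exact norm_pos_iff.2 (sub_ne_zero.2 (h0 i))

/-- The mesh module as a sum over the cyclic index set. -/
theorem meshModule_eq_sum [NeZero n] : meshModule p P = ∑ i : ZMod n,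
    1 / (4 * Real.sin (gammaAngle p P i)) * (edgeLength p P i * edgeLength p P (i + 1)
      - Real.cos (gammaAngle p P i) / 2 * (edgeLength p P i ^ 2 + edgeLength p P (i + 1) ^ 2)) :=
  ZMod.sum_Icc_natCast fun i => 1 / (4 * Real.sin (gammaAngle p P i)) *
    (edgeLength p P i * edgeLength p P (i + 1)
      - Real.cos (gammaAngle p P i) / 2 * (edgeLength p P i ^ 2 + edgeLength p P (i + 1) ^ 2))

/-- Each triangle contributes (2ηη' − cos γ (η² + η'²)) / sin γ, eight times its term in
`meshModule`. -/
theorem sum_cotWeight_mul_sq [NeZero n] (h0 : ∀ i, P i ≠ p)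
    (hs : ∀ i, 0 < Real.sin (gammaAngle p P i)) :
    ∑ i ∈ Finset.Icc 1 n, cotWeight p P (i : ZMod n) * edgeLength p P (i : ZMod n) ^ 2 =
      8 * meshModule p P := by
  have h := sum_cotWeight_smul h0 hs fun i => edgeLength p P i ^ 2
  simp only [smul_eq_mul] at h
  rw [h, meshModule_eq_sum, Finset.mul_sum]
  refine Finset.sum_congr rfl fun i _ => ?_
  have h1 := (edgeLength_pos h0 i).ne'
  have h2 := (edgeLength_pos h0 (i + 1)).ne'
  have h3 := (hs i).ne'
  field_simp
  ring

/-- The cotangent scheme in terms of the mesh module. -/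
theorem meanScheme_eq [NeZero n] (h0 : ∀ i, P i ≠ p)
    (hs : ∀ i, 0 < Real.sin (gammaAngle p P i)) :
    meanScheme p P = 2 * ‖(8 * meshModule p P)⁻¹ •
      ∑ i ∈ Finset.Icc 1 n, cotWeight p P (i : ZMod n) • (P (i : ZMod n) - p)‖ := by
  rw [meanScheme, sum_cotWeight_mul_sq h0 hs]

end Weights

/-! ### One-rings in a tangential coordinate -/

/-- `Z` is a positively oriented orthonormal complex coordinate in the plane orthogonal to the unit
vector `ν`. -/
structure IsTangentCoord (Z : E3 →L[ℝ] ℂ) (ν : E3) : Prop where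
  inner_self : inner ℝ ν ν = (1 : ℝ)
  inner_eq : ∀ x y, inner ℝ x y =
    (starRingEnd ℂ (Z x) * Z y).re + inner ℝ x ν * inner ℝ y ν
  inner_cross : ∀ x y, inner ℝ (cross x y) ν = (starRingEnd ℂ (Z x) * Z y).im

theorem IsTangentCoord.norm_sq {Z : E3 →L[ℝ] ℂ} {ν : E3} (h : IsTangentCoord Z ν) (x : E3) :
    ‖x‖ ^ 2 = ‖Z x‖ ^ 2 + inner ℝ x ν ^ 2 := by
  rw [← real_inner_self_eq_norm_sq, h.inner_eq, mul_comm (starRingEnd ℂ _), Complex.mul_conj,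
    Complex.ofReal_re, Complex.sq_norm]
  ring

theorem IsTangentCoord.apply_normal {Z : E3 →L[ℝ] ℂ} {ν : E3} (h : IsTangentCoord Z ν) :
    Z ν = 0 := by
  have h1 := h.norm_sq ν
  rw [← real_inner_self_eq_norm_sq, h.inner_self] at h1
  have h2 : ‖Z ν‖ ^ 2 = 0 := by linarith
  simpa using h2

theorem IsTangentCoord.norm_le {Z : E3 →L[ℝ] ℂ} {ν : E3} (h : IsTangentCoord Z ν) (x : E3) :
    ‖x‖ ≤ ‖Z x‖ + |inner ℝ x ν| := by
  refine abs_le_of_sq_le_sq' ?_ (by positivity) |>.2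
  rw [h.norm_sq, ← sq_abs (inner ℝ x ν)]
  nlinarith [mul_nonneg (norm_nonneg (Z x)) (abs_nonneg (inner ℝ x ν))]

/-- The tangential component of the unit vector from `p` to `P i`. -/
def tangentDir (Z : E3 →L[ℝ] ℂ) {n : ℕ} (p : E3) (P : ZMod n → E3) (i : ZMod n) : ℂ :=
  (edgeLength p P i)⁻¹ • Z (P i - p)

/-- The normal component of the unit vector from `p` to `P i`. -/
def elevation (ν : E3) {n : ℕ} (p : E3) (P : ZMod n → E3) (i : ZMod n) : ℝ :=
  (edgeLength p P i)⁻¹ * inner ℝ (P i - p) ν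

section Coord

variable {Z : E3 →L[ℝ] ℂ} {ν : E3} {n : ℕ} {p : E3} {P : ZMod n → E3}

theorem norm_tangentDir_sq_add (h : IsTangentCoord Z ν) (h0 : ∀ i, P i ≠ p) (i : ZMod n) :
    ‖tangentDir Z p P i‖ ^ 2 + elevation ν p P i ^ 2 = 1 := by
  have h1 := h.norm_sq (P i - p)
  rw [← edgeLength_eq_norm] at h1
  have h2 := edgeLength_pos h0 i
  rw [tangentDir, elevation, norm_smul, mul_pow, mul_pow, norm_inv, Real.norm_of_nonneg h2.le,
    ← mul_add, ← h1]
  field_simp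

theorem cos_gammaAngle (h : IsTangentCoord Z ν) (i : ZMod n) :
    Real.cos (gammaAngle p P i) =
      (starRingEnd ℂ (tangentDir Z p P i) * tangentDir Z p P (i + 1)).re +
        elevation ν p P i * elevation ν p P (i + 1) := by
  rw [gammaAngle_eq, InnerProductGeometry.cos_angle, h.inner_eq, ← edgeLength_eq_norm,
    ← edgeLength_eq_norm, tangentDir, tangentDir, elevation, elevation]
  simp only [Complex.real_smul, map_mul, Complex.conj_ofReal]
  have h1 : ((edgeLength p P i)⁻¹ : ℂ) * starRingEnd ℂ (Z (P i - p)) *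
      (((edgeLength p P (i + 1))⁻¹ : ℂ) * Z (P (i + 1) - p)) =
      (((edgeLength p P i)⁻¹ * (edgeLength p P (i + 1))⁻¹ : ℝ) : ℂ) *
        (starRingEnd ℂ (Z (P i - p)) * Z (P (i + 1) - p)) := by
    push_cast; ring
  push_cast
  rw [h1, Complex.re_ofReal_mul, div_eq_mul_inv, mul_inv]
  ring

end Coord

section OneRing

variable {Z : E3 →L[ℝ] ℂ} {n : ℕ} {S : Set E3} {F : E2 → E3} {u : E2} {P : ZMod n → E3}

theorem IsTangentCoord.apply_tangentProj_sub (h : IsTangentCoord Z (unitNormal F u)) (x : E3) :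
    Z (tangentProj F u x - F u) = Z (x - F u) := by
  rw [tangentProj, sub_right_comm, map_sub _ (x - F u), map_smul, h.apply_normal, smul_zero,
    sub_zero]

theorem IsTangentCoord.inner_tangentProj_sub (h : IsTangentCoord Z (unitNormal F u)) (x : E3) :
    inner ℝ (tangentProj F u x - F u) (unitNormal F u) = 0 := by
  rw [tangentProj, sub_right_comm, inner_sub_left, inner_smul_left, h.inner_self]
  simp

theorem IsTangentCoord.signedArea_eq (h : IsTangentCoord Z (unitNormal F u)) (i : ZMod n) :
    signedArea F u P i = (starRingEnd ℂ (Z (P i - F u)) * Z (P (i + 1) - F u)).im := by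
  rw [signedArea, h.inner_cross, h.apply_tangentProj_sub, h.apply_tangentProj_sub]

theorem IsTangentCoord.cos_betaAngle (h : IsTangentCoord Z (unitNormal F u)) (i : ZMod n) :
    Real.cos (betaAngle F u P i) =
      (starRingEnd ℂ (Z (P i - F u)) * Z (P (i + 1) - F u)).re /
        (‖Z (P i - F u)‖ * ‖Z (P (i + 1) - F u)‖) := by
  have hn : ∀ x, ‖tangentProj F u x - F u‖ = ‖Z (x - F u)‖ := fun x => by
    rw [← sq_eq_sq₀ (norm_nonneg _) (norm_nonneg _), h.norm_sq, h.apply_tangentProj_sub,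
      h.inner_tangentProj_sub]
    ring
  rw [betaAngle, EuclideanGeometry.angle, vsub_eq_sub, vsub_eq_sub, InnerProductGeometry.cos_angle,
    hn, hn, h.inner_eq, h.apply_tangentProj_sub, h.apply_tangentProj_sub, h.inner_tangentProj_sub]
  simp

theorem betaAngle_mem (i : ZMod n) : betaAngle F u P i ∈ Set.Icc 0 Real.pi :=
  ⟨InnerProductGeometry.angle_nonneg _ _, InnerProductGeometry.angle_le_pi _ _⟩

theorem IsOneRing.apply_ne_zero (hP : IsOneRing S F u P) (h : IsTangentCoord Z (unitNormal F u))
    (i : ZMod n) : Z (P i - F u) ≠ 0 := by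
  intro h0
  have h1 : signedArea F u P i = 0 := by rw [h.signedArea_eq, h0]; simp
  rcases hP.oriented with h2 | h2
  · exact (h2 i).ne' h1
  · exact (h2 i).ne h1

theorem IsOneRing.ne (hP : IsOneRing S F u P) (h : IsTangentCoord Z (unitNormal F u))
    (i : ZMod n) : P i ≠ F u := by
  intro h0
  refine hP.apply_ne_zero h i ?_
  rw [h0, sub_self, map_zero]

theorem IsOneRing.tangentDir_ne_zero (hP : IsOneRing S F u P)
    (h : IsTangentCoord Z (unitNormal F u)) (i : ZMod n) : tangentDir Z (F u) P i ≠ 0 :=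
  smul_ne_zero (inv_ne_zero (edgeLength_pos (hP.ne h) i).ne') (hP.apply_ne_zero h i)

theorem IsOneRing.edgeLength_mul_tangentDir (hP : IsOneRing S F u P)
    (h : IsTangentCoord Z (unitNormal F u)) (i : ZMod n) :
    (edgeLength (F u) P i : ℂ) * tangentDir Z (F u) P i = Z (P i - F u) := by
  have h1 : (edgeLength (F u) P i : ℂ) ≠ 0 := by
    exact_mod_cast (edgeLength_pos (hP.ne h) i).ne'
  rw [tangentDir, Complex.real_smul, Complex.ofReal_inv]
  field_simp

theorem IsOneRing.conj_apply_mul_apply (hP : IsOneRing S F u P)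
    (h : IsTangentCoord Z (unitNormal F u)) (i j : ZMod n) :
    starRingEnd ℂ (Z (P i - F u)) * Z (P j - F u) =
      ((edgeLength (F u) P i * edgeLength (F u) P j : ℝ) : ℂ) *
        (starRingEnd ℂ (tangentDir Z (F u) P i) * tangentDir Z (F u) P j) := by
  rw [← hP.edgeLength_mul_tangentDir h, ← hP.edgeLength_mul_tangentDir h]
  simp only [map_mul, Complex.conj_ofReal]
  push_cast
  ring

/-- A single sign σ records the orientation of the whole ring, so both orientations are treated at
once. -/
theorem IsOneRing.exists_sign (hP : IsOneRing S F u P)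
    (h : IsTangentCoord Z (unitNormal F u)) :
    ∃ σ : ℝ, σ ^ 2 = 1 ∧ ∀ i,
      0 < σ * (starRingEnd ℂ (tangentDir Z (F u) P i) * tangentDir Z (F u) P (i + 1)).im := by
  have h1 : ∀ i, signedArea F u P i = (edgeLength (F u) P i * edgeLength (F u) P (i + 1)) *
      (starRingEnd ℂ (tangentDir Z (F u) P i) * tangentDir Z (F u) P (i + 1)).im := fun i => by
    rw [h.signedArea_eq, hP.conj_apply_mul_apply h, Complex.im_ofReal_mul]
  have h2 : ∀ i, 0 < edgeLength (F u) P i * edgeLength (F u) P (i + 1) := fun i =>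
    mul_pos (edgeLength_pos (hP.ne h) i) (edgeLength_pos (hP.ne h) _)
  rcases hP.oriented with h3 | h3
  · refine ⟨1, by norm_num, fun i => ?_⟩
    rw [one_mul]
    exact pos_of_mul_pos_right (h1 i ▸ h3 i) (h2 i).le
  · refine ⟨-1, by norm_num, fun i => ?_⟩
    have h4 := h3 i
    rw [h1 i] at h4
    have := neg_of_mul_neg_right h4 (h2 i).le
    linarith

theorem IsOneRing.cos_betaAngle (hP : IsOneRing S F u P)
    (h : IsTangentCoord Z (unitNormal F u)) (i : ZMod n) :
    ‖tangentDir Z (F u) P i‖ * ‖tangentDir Z (F u) P (i + 1)‖ * Real.cos (betaAngle F u P i) =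
      (starRingEnd ℂ (tangentDir Z (F u) P i) * tangentDir Z (F u) P (i + 1)).re := by
  have h1 := norm_ne_zero_iff.2 (hP.tangentDir_ne_zero h i)
  have h2 := norm_ne_zero_iff.2 (hP.tangentDir_ne_zero h (i + 1))
  have h3 := edgeLength_pos (hP.ne h) i
  have h4 := edgeLength_pos (hP.ne h) (i + 1)
  rw [h.cos_betaAngle, hP.conj_apply_mul_apply h, Complex.re_ofReal_mul,
    ← hP.edgeLength_mul_tangentDir h i, ← hP.edgeLength_mul_tangentDir h (i + 1), norm_mul,
    norm_mul, Complex.norm_real, Complex.norm_real, Real.norm_of_nonneg h3.le,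
    Real.norm_of_nonneg h4.le]
  field_simp

theorem elevation_sq_le_one (h : IsTangentCoord Z (unitNormal F u)) (h0 : ∀ i, P i ≠ F u)
    (i : ZMod n) : elevation (unitNormal F u) (F u) P i ^ 2 ≤ 1 := by
  have h1 := norm_tangentDir_sq_add h h0 i
  nlinarith [sq_nonneg ‖tangentDir Z (F u) P i‖]

/-- The angles of a one-ring and of its projection to the tangent plane. -/
theorem IsOneRing.cos_gammaAngle_eq (hP : IsOneRing S F u P)
    (h : IsTangentCoord Z (unitNormal F u)) (i : ZMod n) :
    Real.cos (gammaAngle (F u) P i) =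
      √(1 - elevation (unitNormal F u) (F u) P i ^ 2) *
        √(1 - elevation (unitNormal F u) (F u) P (i + 1) ^ 2) * Real.cos (betaAngle F u P i) +
        elevation (unitNormal F u) (F u) P i * elevation (unitNormal F u) (F u) P (i + 1) := by
  have h1 : ∀ j, √(1 - elevation (unitNormal F u) (F u) P j ^ 2) = ‖tangentDir Z (F u) P j‖ :=
    fun j => by
      rw [← norm_tangentDir_sq_add h (hP.ne h) j, add_sub_cancel_right,
        Real.sqrt_sq (norm_nonneg _)]
  rw [cos_gammaAngle h, h1, h1, hP.cos_betaAngle h]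

/-- The cotangent area gradient of a one-ring has a tangential part of third order. -/
theorem IsOneRing.norm_apply_sum_cotWeight_le [NeZero n] (hP : IsOneRing S F u P)
    (h : IsTangentCoord Z (unitNormal F u)) {c : ℝ} (hc : 0 < c) (hc1 : c ≤ 1)
    (hs : ∀ i, c ≤ Real.sin (gammaAngle (F u) P i)) :
    ‖Z (∑ i ∈ Finset.Icc 1 n, cotWeight (F u) P (i : ZMod n) • (P (i : ZMod n) - F u))‖ ≤
      ∑ i : ZMod n, 4 / c ^ 2 * (edgeLength (F u) P i + edgeLength (F u) P (i + 1)) *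
        (elevation (unitNormal F u) (F u) P i ^ 2 +
          elevation (unitNormal F u) (F u) P (i + 1) ^ 2) := by
  obtain ⟨σ, hσ, hσ'⟩ := hP.exists_sign h
  rw [sum_cotWeight_smul (hP.ne h) (fun i => hc.trans_le (hs i)) (fun i => P i - F u), map_sum]
  -- The rotated edges of the closed projected polygon add up to zero, so only the errors of
  -- `area_gradient_bound` survive.
  have htel : ∑ i : ZMod n, (σ * Complex.I) *
      ((edgeLength (F u) P i : ℂ) * tangentDir Z (F u) P i -
        (edgeLength (F u) P (i + 1) : ℂ) * tangentDir Z (F u) P (i + 1)) = 0 := by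
    rw [← Finset.mul_sum, Finset.sum_sub_distrib]
    rw [← Equiv.sum_comp (Equiv.addRight (1 : ZMod n)) fun i =>
      (edgeLength (F u) P i : ℂ) * tangentDir Z (F u) P i]
    simp
  rw [← sub_zero (∑ i : ZMod n, Z _), ← htel, ← Finset.sum_sub_distrib]
  refine (norm_sum_le _ _).trans (Finset.sum_le_sum fun i _ => ?_)
  have h1 := area_gradient_bound (σ := σ) hc hc1 (edgeLength_pos (hP.ne h) i).le
    (edgeLength_pos (hP.ne h) (i + 1)).le (hs i) (Real.sin_sq_add_cos_sq _)
    (norm_tangentDir_sq_add h (hP.ne h) i) (norm_tangentDir_sq_add h (hP.ne h) (i + 1))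
    (cos_gammaAngle h i) hσ (hσ' i).le
  simpa only [map_add, map_smul, tangentDir] using h1

/-- The normal part of the cotangent area gradient. -/
theorem inner_sum_cotWeight [NeZero n] {p ν : E3} (h0 : ∀ i, P i ≠ p)
    (hs : ∀ i, 0 < Real.sin (gammaAngle p P i)) :
    inner ℝ (∑ i ∈ Finset.Icc 1 n, cotWeight p P (i : ZMod n) • (P (i : ZMod n) - p)) ν =
      ∑ i : ZMod n,
        ((edgeLength p P (i + 1) - edgeLength p P i * Real.cos (gammaAngle p P i)) /
          Real.sin (gammaAngle p P i) * elevation ν p P i +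
        (edgeLength p P i - edgeLength p P (i + 1) * Real.cos (gammaAngle p P i)) /
          Real.sin (gammaAngle p P i) * elevation ν p P (i + 1)) := by
  rw [sum_inner]
  simp only [inner_smul_left, conj_trivial]
  exact sum_cotWeight_smul h0 hs fun i => inner ℝ (P i - p) ν

end OneRing

/-! ### Asymptotics along shrinking one-rings -/

open Asymptotics in
-- ff' − gg' = (f − g)f' + g(f' − g'): approximations to first order multiply to approximations to
-- second order.
theorem isLittleO_mul_sub_mul {ι : Type*} {l : Filter ι} {f f' g g' δ : ι → ℝ}
    (h : (fun t => f t - g t) =o[l] δ) (h' : (fun t => f' t - g' t) =o[l] δ)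
    (hg : g =O[l] δ) (hg' : g' =O[l] δ) :
    (fun t => f t * f' t - g t * g' t) =o[l] fun t => δ t ^ 2 := by
  have hf' : f' =O[l] δ := by simpa using h'.isBigO.add hg'
  have h1 := (h.mul_isBigO hf').add (hg.mul_isLittleO h')
  refine (h1.congr_left fun t => ?_).congr_right fun t => ?_ <;> ring

open Asymptotics in
theorem isBigO_const_mul_of_abs_le {ι : Type*} {l : Filter ι} {f g : ι → ℝ} (C : ℝ)
    (h : ∀ᶠ t in l, |f t| ≤ C * |g t|) : f =O[l] g :=
  IsBigO.of_bound C (by simpa only [Real.norm_eq_abs] using h)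

open Asymptotics in
/-- The angular defect of a single triangle, when the elevations `s, s'` are known to first
order. -/
theorem angle_defect_isLittleO {ι : Type*} {l : Filter ι} {β γ s s' g g' δ : ι → ℝ} {c : ℝ}
    (hc : 0 < c) (hβ : ∀ t, β t ∈ Set.Icc 0 Real.pi) (hγ : ∀ t, γ t ∈ Set.Icc 0 Real.pi)
    (hsin : ∀ᶠ t in l, c ≤ Real.sin (γ t)) (hs : ∀ᶠ t in l, s t ^ 2 ≤ 1)
    (hs' : ∀ᶠ t in l, s' t ^ 2 ≤ 1)
    (hcos : ∀ᶠ t in l, Real.cos (γ t) =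
      √(1 - s t ^ 2) * √(1 - s' t ^ 2) * Real.cos (β t) + s t * s' t)
    (hδ : Tendsto δ l (𝓝 0)) (hg : g =O[l] δ) (hg' : g' =O[l] δ)
    (h : (fun t => s t - g t) =o[l] δ) (h' : (fun t => s' t - g' t) =o[l] δ) :
    (fun t => (β t - γ t) -
      (g t * g' t - Real.cos (γ t) / 2 * (g t ^ 2 + g' t ^ 2)) / Real.sin (γ t)) =o[l]
      fun t => δ t ^ 2 := by
  have hsO : s =O[l] δ := by simpa using h.isBigO.add hg
  have hsO' : s' =O[l] δ := by simpa using h'.isBigO.add hg'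
  have hρ : (fun t => s t ^ 2 + s' t ^ 2) =O[l] fun t => δ t ^ 2 := (hsO.pow 2).add (hsO'.pow 2)
  have hδ2 : (fun t => δ t ^ 2) =o[l] fun _ => (1 : ℝ) := by
    rw [isLittleO_one_iff]
    simpa using hδ.pow 2
  have h1 : (fun t => (β t - γ t) - (s t * s' t - Real.cos (γ t) / 2 * (s t ^ 2 + s' t ^ 2)) /
      Real.sin (γ t)) =o[l] fun t => δ t ^ 2 := by
    -- The error of `angle_defect_bound` is of order δ⁴, hence o(δ²).
    have h2 : (fun t => (s t ^ 2 + s' t ^ 2) ^ 2) =o[l] fun t => δ t ^ 2 := by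
      have := hρ.mul_isLittleO (hρ.trans_isLittleO hδ2)
      simpa only [pow_two, mul_one] using this
    refine IsBigO.trans_isLittleO ?_ h2
    refine isBigO_const_mul_of_abs_le (((2 * Real.pi / c) ^ 2 + 3) / c) ?_
    filter_upwards [hsin, hs, hs', hcos] with t h3 h4 h5 h6
    rw [abs_of_nonneg (sq_nonneg (s t ^ 2 + s' t ^ 2))]
    exact (angle_defect_bound hc (hβ t) (hγ t) h3 h4 h5 h6).2
  have hinv : (fun t => (Real.sin (γ t))⁻¹) =O[l] fun _ => (1 : ℝ) := by
    refine isBigO_const_mul_of_abs_le c⁻¹ ?_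
    filter_upwards [hsin] with t ht
    rw [abs_one, mul_one, abs_of_pos (inv_pos.2 (hc.trans_le ht))]
    gcongr
  have hcosO : (fun t => Real.cos (γ t) / 2) =O[l] fun _ => (1 : ℝ) := by
    refine isBigO_const_mul_of_abs_le 1 (Eventually.of_forall fun t => ?_)
    have := Real.abs_cos_le_one (γ t)
    rw [abs_div, abs_two, abs_one]
    linarith
  have h2 : (fun t => (s t * s' t - g t * g' t) - Real.cos (γ t) / 2 *
      ((s t * s t - g t * g t) + (s' t * s' t - g' t * g' t))) =o[l] fun t => δ t ^ 2 := by
    refine (isLittleO_mul_sub_mul h h' hg hg').sub ?_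
    have := hcosO.mul_isLittleO
      ((isLittleO_mul_sub_mul h h hg hg).add (isLittleO_mul_sub_mul h' h' hg' hg'))
    simpa only [one_mul] using this
  have h3 := hinv.mul_isLittleO h2
  simp only [one_mul] at h3
  refine (h1.add h3).congr_left fun t => ?_
  ring

/-- The normal curvature in the direction `z`, for the second fundamental form `planeForm H D`. -/
def normalCurv (H : ℝ) (D z : ℂ) : ℝ := H + (D * (z / ‖z‖) ^ 2).re

theorem planeForm_eq_normalCurv (H : ℝ) (D : ℂ) {z : ℂ} (hz : z ≠ 0) :
    planeForm H D z = ‖z‖ ^ 2 * normalCurv H D z := by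
  have h1 : (‖z‖ : ℂ) ≠ 0 := by exact_mod_cast norm_ne_zero_iff.2 hz
  have h2 : D * z ^ 2 = ((‖z‖ ^ 2 : ℝ) : ℂ) * (D * (z / ‖z‖) ^ 2) := by
    push_cast
    field_simp
  rw [planeForm, normalCurv, h2, Complex.re_ofReal_mul]
  ring

/-- D is multiplied by a number of modulus at most 1 (0 when z = 0). The bound is uniform, which
matters because the edge directions need not converge along the family. -/
theorem abs_normalCurv_le (H : ℝ) (D z : ℂ) : |normalCurv H D z| ≤ |H| + ‖D‖ := by
  refine (abs_add_le _ _).trans (add_le_add_right ?_ _)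
  refine (Complex.abs_re_le_norm _).trans ?_
  have h1 : ‖z / ‖z‖‖ ≤ 1 := by
    rw [norm_div, Complex.norm_real, norm_norm]
    exact div_self_le_one _
  rw [norm_mul, norm_pow]
  have h2 : ‖z / ‖z‖‖ ^ 2 ≤ 1 := pow_le_one₀ (norm_nonneg _) h1
  nlinarith [norm_nonneg D]

theorem planeForm_real_mul (H : ℝ) (D z : ℂ) (r : ℝ) :
    planeForm H D (r * z) = r ^ 2 * planeForm H D z := by
  have h1 : D * ((r : ℂ) * z) ^ 2 = ((r ^ 2 : ℝ) : ℂ) * (D * z ^ 2) := by push_cast; ring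
  rw [planeForm, planeForm, h1, Complex.re_ofReal_mul, norm_mul, Complex.norm_real, mul_pow,
    Real.norm_eq_abs, sq_abs]
  ring

/-- The elevation predicted by the normal curvature. -/
def curvElevation (H : ℝ) (D : ℂ) (Z : E3 →L[ℝ] ℂ) {n : ℕ} (p : E3) (P : ZMod n → E3)
    (i : ZMod n) : ℝ :=
  normalCurv H D (tangentDir Z p P i) * edgeLength p P i / 2

/-- A family of one-rings of a point of a surface that shrinks to the point, with a tangential
coordinate in which the second fundamental form is `planeForm H D`. -/
structure IsShrinkingFamily {ι : Type*} {n : ℕ} (S : Set E3) (F : E2 → E3) (u : E2)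
    (Z : E3 →L[ℝ] ℂ) (H : ℝ) (D : ℂ) (l : Filter ι) (P : ι → ZMod n → E3) : Prop where
  coord : IsTangentCoord Z (unitNormal F u)
  height : ∀ ε > 0, ∃ r > 0, ∀ x ∈ S, dist (F u) x < r →
    |inner ℝ (x - F u) (unitNormal F u) - planeForm H D (Z (x - F u)) / 2| ≤ ε * ‖x - F u‖ ^ 2
  ring : ∀ᶠ t in l, IsOneRing S F u (P t)
  shrink : ∀ i, Tendsto (fun t => edgeLength (F u) (P t) i) l (𝓝 0)

/-- The sum of the edge lengths at the centre of a one-ring. -/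
def totalLength {n : ℕ} [NeZero n] (p : E3) (P : ZMod n → E3) : ℝ := ∑ i, edgeLength p P i

theorem edgeLength_nonneg {n : ℕ} (p : E3) (P : ZMod n → E3) (i : ZMod n) :
    0 ≤ edgeLength p P i := dist_nonneg

theorem edgeLength_le_totalLength {n : ℕ} [NeZero n] (p : E3) (P : ZMod n → E3) (i : ZMod n) :
    edgeLength p P i ≤ totalLength p P :=
  Finset.single_le_sum (fun j _ => edgeLength_nonneg p P j) (Finset.mem_univ i)

theorem totalLength_nonneg {n : ℕ} [NeZero n] (p : E3) (P : ZMod n → E3) :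
    0 ≤ totalLength p P := Finset.sum_nonneg fun i _ => edgeLength_nonneg p P i

namespace IsShrinkingFamily

open Asymptotics

variable {ι : Type*} {n : ℕ} {S : Set E3} {F : E2 → E3} {u : E2} {Z : E3 →L[ℝ] ℂ}
  {H : ℝ} {D : ℂ} {l : Filter ι} {P : ι → ZMod n → E3}

theorem normalCurv_isBigO (i : ZMod n) :
    (fun t => normalCurv H D (tangentDir Z (F u) (P t) i)) =O[l] fun _ => (1 : ℝ) := by
  refine isBigO_const_mul_of_abs_le (|H| + ‖D‖) (Eventually.of_forall fun t => ?_)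
  rw [abs_one, mul_one]
  exact abs_normalCurv_le _ _ _

theorem inv_sin_isBigO {c : ℝ} (hc : 0 < c)
    (hsin : ∀ᶠ t in l, ∀ i, c ≤ Real.sin (gammaAngle (F u) (P t) i)) (i : ZMod n) :
    (fun t => (Real.sin (gammaAngle (F u) (P t) i))⁻¹) =O[l] fun _ => (1 : ℝ) := by
  refine isBigO_const_mul_of_abs_le c⁻¹ ?_
  filter_upwards [hsin] with t ht
  rw [abs_one, mul_one, abs_of_pos (inv_pos.2 (hc.trans_le (ht i)))]
  gcongr
  exact ht i

theorem cos_isBigO (i : ZMod n) :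
    (fun t => Real.cos (gammaAngle (F u) (P t) i)) =O[l] fun _ => (1 : ℝ) := by
  refine isBigO_const_mul_of_abs_le 1 (Eventually.of_forall fun t => ?_)
  rw [abs_one, mul_one]
  exact Real.abs_cos_le_one _

variable [NeZero n]

theorem tendsto_totalLength (h : IsShrinkingFamily S F u Z H D l P) :
    Tendsto (fun t => totalLength (F u) (P t)) l (𝓝 0) := by
  simpa [totalLength] using tendsto_finsetSum Finset.univ fun i _ => h.shrink i

theorem edgeLength_isBigO (p : E3) (i : ZMod n) :
    (fun t => edgeLength p (P t) i) =O[l] fun t => totalLength p (P t) := by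
  refine isBigO_const_mul_of_abs_le 1 (Eventually.of_forall fun t => ?_)
  rw [one_mul, abs_of_nonneg (edgeLength_nonneg _ _ _), abs_of_nonneg (totalLength_nonneg _ _)]
  exact edgeLength_le_totalLength _ _ _

theorem eventually_totalLength_pos (h : IsShrinkingFamily S F u Z H D l P) :
    ∀ᶠ t in l, 0 < totalLength (F u) (P t) := by
  filter_upwards [h.ring] with t ht
  exact (edgeLength_pos (ht.ne h.coord) 0).trans_le (edgeLength_le_totalLength _ _ _)

/-- The elevation to first order, as predicted by the normal curvature. -/
theorem elevation_sub_isLittleO (h : IsShrinkingFamily S F u Z H D l P) (i : ZMod n) :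
    (fun t => elevation (unitNormal F u) (F u) (P t) i -
      curvElevation H D Z (F u) (P t) i) =o[l]
      fun t => totalLength (F u) (P t) := by
  refine IsLittleO.trans_isBigO ?_ (edgeLength_isBigO (F u) i)
  set s := fun t => elevation (unitNormal F u) (F u) (P t) i
  set η := fun t => edgeLength (F u) (P t) i
  set κ := fun t => normalCurv H D (tangentDir Z (F u) (P t) i)
  have hκ : κ =O[l] fun _ => (1 : ℝ) := normalCurv_isBigO i
  have hs1 : ∀ᶠ t in l, s t ^ 2 ≤ 1 := by
    filter_upwards [h.ring] with t ht
    exact elevation_sq_le_one h.coord (ht.ne h.coord) i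
  -- The height estimate divided by η; the factor 1 − s² is the squared length of the tangential
  -- part of the unit edge vector.
  have h1 : (fun t => s t - (1 - s t ^ 2) * κ t * η t / 2) =o[l] η := by
    rw [isLittleO_iff]
    intro ε hε
    obtain ⟨r, hr, hh⟩ := h.height ε hε
    filter_upwards [h.ring, (h.shrink i).eventually (gt_mem_nhds hr)] with t ht htr
    have hη : 0 < η t := edgeLength_pos (ht.ne h.coord) i
    have h2 := hh (P t i) (ht.mem i) htr
    rw [← ht.edgeLength_mul_tangentDir h.coord, planeForm_real_mul,
      planeForm_eq_normalCurv _ _ (ht.tangentDir_ne_zero h.coord i), ← edgeLength_eq_norm] at h2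
    have h3 : inner ℝ (P t i - F u) (unitNormal F u) = η t * s t := by
      simp only [s, elevation]
      rw [mul_inv_cancel_left₀ hη.ne']
    have h4 : ‖tangentDir Z (F u) (P t) i‖ ^ 2 = 1 - s t ^ 2 := by
      rw [← norm_tangentDir_sq_add h.coord (ht.ne h.coord) i]
      simp [s]
    rw [h3, h4] at h2
    have h5 : η t * s t - η t ^ 2 * ((1 - s t ^ 2) * κ t) / 2 =
        η t * (s t - (1 - s t ^ 2) * κ t * η t / 2) := by ring
    change |η t * s t - η t ^ 2 * ((1 - s t ^ 2) * κ t) / 2| ≤ ε * η t ^ 2 at h2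
    rw [h5, abs_mul, abs_of_pos hη] at h2
    rw [Real.norm_eq_abs, Real.norm_of_nonneg hη.le]
    exact le_of_mul_le_mul_left (by linarith) hη
  have h2 : (fun t => (1 - s t ^ 2) * κ t * η t / 2) =O[l] η := by
    have h3 : (fun t => 1 - s t ^ 2) =O[l] fun _ => (1 : ℝ) := by
      refine isBigO_const_mul_of_abs_le 1 ?_
      filter_upwards [hs1] with t ht
      rw [abs_one, abs_of_nonneg (by linarith)]
      nlinarith [sq_nonneg (s t)]
    have h4 := ((h3.mul hκ).mul (isBigO_refl η l)).const_mul_left 2⁻¹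
    refine (h4.congr_left fun t => ?_).congr_right fun t => ?_ <;> ring
  -- Bootstrap: the crude bound s = O(η) makes the discarded term s²κη/2 negligible.
  have hsO : s =O[l] η := by simpa using h1.isBigO.add h2
  have hs0 : s =o[l] fun _ => (1 : ℝ) :=
    hsO.trans_isLittleO ((isLittleO_one_iff ℝ).2 (h.shrink i))
  have h5 : (fun t => s t ^ 2 * (κ t * η t / 2)) =o[l] η := by
    have h6 := ((hs0.pow two_pos).mul_isBigO (hκ.mul (isBigO_refl η l))).const_mul_left 2⁻¹
    refine (h6.congr_left fun t => ?_).congr_right fun t => ?_ <;> ring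
  refine (h1.sub h5).congr_left fun t => ?_
  simp only [curvElevation, s, κ, η]
  ring

theorem curvElevation_isBigO (i : ZMod n) :
    (fun t => curvElevation H D Z (F u) (P t) i) =O[l]
      fun t => totalLength (F u) (P t) := by
  have h := ((normalCurv_isBigO (l := l) (P := P) (H := H) (D := D) (Z := Z) (F := F) (u := u)
    i).mul (edgeLength_isBigO (l := l) (P := P) (F u) i)).const_mul_left 2⁻¹
  refine (h.congr_left fun t => ?_).congr_right fun t => one_mul _
  rw [curvElevation]
  ring

/-- The angular defect to second order. -/
theorem angularDefect_sub_isLittleO (h : IsShrinkingFamily S F u Z H D l P) {c : ℝ} (hc : 0 < c)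
    (hsin : ∀ᶠ t in l, ∀ i, c ≤ Real.sin (gammaAngle (F u) (P t) i)) :
    (fun t => angularDefect (F u) (P t) - ∑ i : ZMod n,
      ((curvElevation H D Z (F u) (P t) i) *
        (curvElevation H D Z (F u) (P t) (i + 1)) -
        Real.cos (gammaAngle (F u) (P t) i) / 2 *
        ((curvElevation H D Z (F u) (P t) i) ^ 2 +
        (curvElevation H D Z (F u) (P t) (i + 1)) ^ 2)) / Real.sin (gammaAngle (F u) (P t) i)) =o[l]
      fun t => totalLength (F u) (P t) ^ 2 := by
  have h1 := IsLittleO.sum (s := Finset.univ) fun (i : ZMod n) _ =>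
    angle_defect_isLittleO (l := l) (β := fun t => betaAngle F u (P t) i)
      (γ := fun t => gammaAngle (F u) (P t) i)
      (s := fun t => elevation (unitNormal F u) (F u) (P t) i)
      (s' := fun t => elevation (unitNormal F u) (F u) (P t) (i + 1)) hc
      (fun t => betaAngle_mem i) (fun t => gammaAngle_mem i) (hsin.mono fun t ht => ht i)
      (h.ring.mono fun t ht => elevation_sq_le_one h.coord (ht.ne h.coord) i)
      (h.ring.mono fun t ht => elevation_sq_le_one h.coord (ht.ne h.coord) (i + 1))
      (h.ring.mono fun t ht => ht.cos_gammaAngle_eq h.coord i) h.tendsto_totalLength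
      (curvElevation_isBigO i) (curvElevation_isBigO (i + 1))
      (h.elevation_sub_isLittleO i) (h.elevation_sub_isLittleO (i + 1))
  refine h1.congr' ?_ (EventuallyEq.refl _ _)
  filter_upwards [h.ring] with t ht
  -- The winding condition replaces 2π by the sum of the β_i, turning the defect into a sum over
  -- triangles.
  have h2 := ht.winding
  rw [ZMod.sum_Icc_natCast (fun i => betaAngle F u (P t) i)] at h2
  rw [Finset.sum_apply, Finset.sum_sub_distrib, angularDefect, ← h2,
    ZMod.sum_Icc_natCast (fun i => gammaAngle (F u) (P t) i), Finset.sum_sub_distrib]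

theorem edge_sub_isBigO {c : ℝ} (hc : 0 < c)
    (hsin : ∀ᶠ t in l, ∀ i, c ≤ Real.sin (gammaAngle (F u) (P t) i)) (i j k : ZMod n) :
    (fun t => (edgeLength (F u) (P t) j -
      edgeLength (F u) (P t) k * Real.cos (gammaAngle (F u) (P t) i)) /
        Real.sin (gammaAngle (F u) (P t) i)) =O[l] fun t => totalLength (F u) (P t) := by
  have h1 : (fun t => edgeLength (F u) (P t) k * Real.cos (gammaAngle (F u) (P t) i)) =O[l]
      fun t => totalLength (F u) (P t) := by
    simpa using (edgeLength_isBigO (P := P) (F u) k).mul (cos_isBigO (P := P) (F := F) (u := u) i)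
  have h2 := ((edgeLength_isBigO (P := P) (F u) j).sub h1).mul (inv_sin_isBigO hc hsin i)
  simpa [div_eq_mul_inv] using h2

/-- The cotangent area gradient to second order. -/
theorem sum_cotWeight_sub_isLittleO (h : IsShrinkingFamily S F u Z H D l P) {c : ℝ} (hc : 0 < c)
    (hsin : ∀ᶠ t in l, ∀ i, c ≤ Real.sin (gammaAngle (F u) (P t) i)) :
    (fun t => ∑ i ∈ Finset.Icc 1 n, cotWeight (F u) (P t) (i : ZMod n) •
        (P t (i : ZMod n) - F u) -
      (∑ i : ZMod n,
        ((edgeLength (F u) (P t) (i + 1) -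
            edgeLength (F u) (P t) i * Real.cos (gammaAngle (F u) (P t) i)) /
          Real.sin (gammaAngle (F u) (P t) i) * curvElevation H D Z (F u) (P t) i +
        (edgeLength (F u) (P t) i -
            edgeLength (F u) (P t) (i + 1) * Real.cos (gammaAngle (F u) (P t) i)) /
          Real.sin (gammaAngle (F u) (P t) i) * curvElevation H D Z (F u) (P t) (i + 1))) •
        unitNormal F u) =o[l] fun t => totalLength (F u) (P t) ^ 2 := by
  set δ := fun t => totalLength (F u) (P t)
  have hδ : δ =o[l] fun _ => (1 : ℝ) := (isLittleO_one_iff ℝ).2 h.tendsto_totalLength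
  have hsO : ∀ i, (fun t => elevation (unitNormal F u) (F u) (P t) i) =O[l] δ := fun i => by
    simpa using (h.elevation_sub_isLittleO i).isBigO.add (curvElevation_isBigO (H := H) (D := D) (Z := Z) i)
  have hT : (fun t => ‖Z (∑ i ∈ Finset.Icc 1 n, cotWeight (F u) (P t) (i : ZMod n) •
        (P t (i : ZMod n) - F u))‖) =o[l] fun t => δ t ^ 2 := by
    -- The tangential part is of third order. The constant is cut down to min c 1 because
    -- `area_gradient_bound` is stated for constants at most 1.
    have hb : (fun t => ∑ i : ZMod n, 4 / min c 1 ^ 2 *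
        (edgeLength (F u) (P t) i + edgeLength (F u) (P t) (i + 1)) *
        (elevation (unitNormal F u) (F u) (P t) i ^ 2 +
          elevation (unitNormal F u) (F u) (P t) (i + 1) ^ 2)) =o[l] fun t => δ t ^ 2 := by
      refine IsLittleO.fun_sum fun i _ => ?_
      have h1 := (((edgeLength_isBigO (P := P) (l := l) (F u) i).add
        (edgeLength_isBigO (P := P) (F u) (i + 1))).const_mul_left (4 / min c 1 ^ 2)).trans_isLittleO
          hδ
      have h2 := h1.mul_isBigO (((hsO i).pow 2).add ((hsO (i + 1)).pow 2))
      simpa only [one_mul] using h2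
    refine IsBigO.trans_isLittleO ?_ hb
    refine isBigO_const_mul_of_abs_le 1 ?_
    filter_upwards [h.ring, hsin] with t ht hst
    rw [one_mul, abs_norm]
    exact (ht.norm_apply_sum_cotWeight_le h.coord (lt_min hc one_pos) (min_le_right _ _)
      fun i => (min_le_left _ _).trans (hst i)).trans (le_abs_self _)
  have hN : (fun t => ∑ i : ZMod n,
        ((edgeLength (F u) (P t) (i + 1) -
            edgeLength (F u) (P t) i * Real.cos (gammaAngle (F u) (P t) i)) /
          Real.sin (gammaAngle (F u) (P t) i) * (elevation (unitNormal F u) (F u) (P t) i -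
            curvElevation H D Z (F u) (P t) i) +
        (edgeLength (F u) (P t) i -
            edgeLength (F u) (P t) (i + 1) * Real.cos (gammaAngle (F u) (P t) i)) /
          Real.sin (gammaAngle (F u) (P t) i) * (elevation (unitNormal F u) (F u) (P t) (i + 1) -
            curvElevation H D Z (F u) (P t) (i + 1)))) =o[l] fun t => δ t ^ 2 := by
    refine IsLittleO.fun_sum fun i _ => ?_
    have h1 := (edge_sub_isBigO hc hsin i (i + 1) i).mul_isLittleO (h.elevation_sub_isLittleO i)
    have h2 := (edge_sub_isBigO hc hsin i i (i + 1)).mul_isLittleO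
      (h.elevation_sub_isLittleO (i + 1))
    simpa only [pow_two] using h1.add h2
  refine IsBigO.trans_isLittleO (IsBigO.of_bound 1 ?_) (hT.add hN.norm_left)
  filter_upwards [h.ring, hsin] with t ht hst
  rw [one_mul, Real.norm_of_nonneg (by positivity)]
  refine (h.coord.norm_le _).trans (le_of_eq ?_)
  rw [map_sub, map_smul, h.coord.apply_normal, smul_zero, sub_zero, inner_sub_left,
    inner_smul_left, h.coord.inner_self, conj_trivial, mul_one,
    inner_sum_cotWeight (ht.ne h.coord) (fun i => hc.trans_le (hst i)),
    ← Finset.sum_sub_distrib, Real.norm_eq_abs]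
  congr 2
  refine Finset.sum_congr rfl fun i _ => ?_
  ring

theorem edge_mul_edge_isBigO (p : E3) (i j : ZMod n) :
    (fun t => edgeLength p (P t) i * edgeLength p (P t) j) =O[l]
      fun t => totalLength p (P t) ^ 2 := by
  simpa only [pow_two] using (edgeLength_isBigO (P := P) p i).mul (edgeLength_isBigO (P := P) p j)

/-- Bounded coefficients times products of two edge lengths. Together with `trigSum_isBigO` this
absorbs the o(1) error made by replacing the squared mean scheme with H². -/
theorem meshModule_isBigO {c : ℝ} (hc : 0 < c)
    (hsin : ∀ᶠ t in l, ∀ i, c ≤ Real.sin (gammaAngle (F u) (P t) i)) :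
    (fun t => meshModule (F u) (P t)) =O[l] fun t => totalLength (F u) (P t) ^ 2 := by
  simp only [meshModule_eq_sum]
  refine IsBigO.fun_sum fun i _ => ?_
  have h1 := ((cos_isBigO (P := P) (l := l) (F := F) (u := u) i).const_mul_left 2⁻¹).mul
    ((edge_mul_edge_isBigO (P := P) (F u) i i).add
      (edge_mul_edge_isBigO (P := P) (F u) (i + 1) (i + 1)))
  simp only [one_mul] at h1
  have h2 := ((inv_sin_isBigO hc hsin i).const_mul_left 4⁻¹).mul
    ((edge_mul_edge_isBigO (P := P) (F u) i (i + 1)).sub h1)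
  simp only [one_mul] at h2
  refine h2.congr_left fun t => ?_
  rw [one_div, mul_inv]
  ring

theorem trigSum_isBigO {c : ℝ} (hc : 0 < c)
    (hsin : ∀ᶠ t in l, ∀ i, c ≤ Real.sin (gammaAngle (F u) (P t) i)) :
    (fun t => trigSum (F u) (P t)) =O[l] fun t => totalLength (F u) (P t) ^ 2 := by
  refine IsBigO.fun_sum fun i _ => ?_
  have hsq : ∀ j : ℕ, (fun t => Real.sin (phiAngle (F u) (P t) j) ^ 2) =O[l]
      fun _ => (1 : ℝ) := fun j => by
    refine isBigO_const_mul_of_abs_le 1 (Eventually.of_forall fun t => ?_)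
    rw [abs_one, mul_one, abs_of_nonneg (sq_nonneg _)]
    exact Real.sin_sq_le_one _
  have hcc : (fun t => 1 - Real.cos (2 * phiAngle (F u) (P t) i) *
      Real.cos (2 * phiAngle (F u) (P t) (i + 1))) =O[l] fun _ => (1 : ℝ) := by
    refine isBigO_const_mul_of_abs_le 2 (Eventually.of_forall fun t => ?_)
    rw [abs_one, mul_one]
    refine (abs_sub _ _).trans ?_
    rw [abs_one, abs_mul]
    have := mul_le_mul (Real.abs_cos_le_one (2 * phiAngle (F u) (P t) i))
      (Real.abs_cos_le_one (2 * phiAngle (F u) (P t) (i + 1))) (abs_nonneg _) zero_le_one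
    linarith
  have h1 := ((cos_isBigO (P := P) (l := l) (F := F) (u := u) (i : ZMod n)).const_mul_left 4⁻¹).mul
    (((edge_mul_edge_isBigO (P := P) (F u) i i).mul (hsq i)).add
      ((edge_mul_edge_isBigO (P := P) (F u) (i + 1) (i + 1)).mul (hsq (i + 1))))
  have h2 := ((edge_mul_edge_isBigO (P := P) (l := l) (F u) i (i + 1)).const_mul_left 2⁻¹).mul hcc
  simp only [one_mul, mul_one] at h1 h2
  have h3 := ((inv_sin_isBigO hc hsin (i : ZMod n)).const_mul_left 4⁻¹).mul (h2.sub h1)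
  simp only [one_mul] at h3
  refine h3.congr_left fun t => ?_
  rw [one_div, mul_inv]
  ring

end IsShrinkingFamily

open Asymptotics in
/-- Convergence of the scheme from the second order expansions of the angular defect and of the
cotangent area gradient. -/
theorem tendsto_gaussScheme {ι : Type*} {n : ℕ} [NeZero n] {l : Filter ι} {p ν : E3}
    {P : ι → ZMod n → E3} {G H : ℝ} {δ : ι → ℝ} (hν : ‖ν‖ = 1)
    (h0 : ∀ᶠ t in l, ∀ i, P t i ≠ p)
    (hs : ∀ᶠ t in l, ∀ i, 0 < Real.sin (gammaAngle p (P t) i))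
    (hδ : ∀ᶠ t in l, 0 < δ t)
    (hS : (fun t => meshModule p (P t)) =O[l] fun t => δ t ^ 2)
    (hA : (fun t => trigSum p (P t)) =O[l] fun t => δ t ^ 2)
    (hS' : (fun t => δ t ^ 2) =O[l] fun t => meshModule p (P t))
    (hA' : (fun t => δ t ^ 2) =O[l] fun t => 2 * trigSum p (P t) - meshModule p (P t))
    (hdef : (fun t => angularDefect p (P t) -
      (G * (2 * trigSum p (P t) - meshModule p (P t)) +
        2 * (meshModule p (P t) - trigSum p (P t)) * H ^ 2)) =o[l] fun t => δ t ^ 2)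
    (hvec : (fun t => ∑ i ∈ Finset.Icc 1 n, cotWeight p (P t) (i : ZMod n) •
      (P t (i : ZMod n) - p) - (4 * H * meshModule p (P t)) • ν) =o[l] fun t => δ t ^ 2) :
    Tendsto (fun t => gaussScheme p (P t)) l (𝓝 G) := by
  have ne_of_isBigO : ∀ {f : ι → ℝ}, (fun t => δ t ^ 2) =O[l] f → ∀ᶠ t in l, f t ≠ 0 := by
    intro f hf
    filter_upwards [hf.eq_zero_imp, hδ] with t ht hδt h1
    exact (pow_pos hδt 2).ne' (ht h1)
  have hS0 := ne_of_isBigO hS'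
  have hA0 := ne_of_isBigO hA'
  set V := fun t => ∑ i ∈ Finset.Icc 1 n, cotWeight p (P t) (i : ZMod n) •
      (P t (i : ZMod n) - p) with hV
  -- The norm loses the sign of H, which is harmless since only the square enters the scheme.
  have hM : Tendsto (fun t => meanScheme p (P t)) l (𝓝 |H|) := by
    have h1 : (fun t => (meshModule p (P t))⁻¹ • (V t - (4 * H * meshModule p (P t)) • ν)) =o[l]
        fun _ => (1 : ℝ) := by
      have h2 := (isBigO_refl (fun t => (meshModule p (P t))⁻¹) l).smul_isLittleO
        (hvec.trans_isBigO hS')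
      refine h2.trans_isBigO (isBigO_const_mul_of_abs_le 1 ?_)
      filter_upwards [hS0] with t ht
      simp [ht]
    rw [isLittleO_one_iff] at h1
    have h2 : Tendsto (fun t => (8 * meshModule p (P t))⁻¹ • V t) l (𝓝 ((H / 2) • ν)) := by
      have h3 := (h1.const_smul (8⁻¹ : ℝ)).add_const ((H / 2) • ν)
      rw [smul_zero, zero_add] at h3
      refine h3.congr' ?_
      filter_upwards [hS0] with t ht
      have h4 : (8⁻¹ * (meshModule p (P t))⁻¹ * (4 * H * meshModule p (P t)) : ℝ) = H / 2 := by
        field_simp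
        ring
      rw [smul_smul, smul_sub, smul_smul _ _ ν, h4, sub_add_cancel, mul_inv]
    have h3 := (h2.norm.const_mul 2)
    rw [norm_smul, hν, Real.norm_eq_abs, abs_div, abs_two, mul_one, mul_div_cancel₀ _ two_ne_zero]
      at h3
    refine h3.congr' ?_
    filter_upwards [h0, hs] with t ht hst
    rw [meanScheme_eq ht hst]
  have hM2 : (fun t => H ^ 2 - meanScheme p (P t) ^ 2) =o[l] fun _ => (1 : ℝ) := by
    rw [isLittleO_one_iff]
    have := (hM.pow 2).const_sub (H ^ 2)
    rwa [sq_abs, sub_self] at this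
  have hnum : (fun t => angularDefect p (P t) -
      2 * (meshModule p (P t) - trigSum p (P t)) * meanScheme p (P t) ^ 2 -
      G * (2 * trigSum p (P t) - meshModule p (P t))) =o[l]
      fun t => 2 * trigSum p (P t) - meshModule p (P t) := by
    refine IsLittleO.trans_isBigO ?_ hA'
    have h1 := ((hS.sub hA).const_mul_left 2).mul_isLittleO hM2
    simp only [mul_one] at h1
    refine (hdef.add h1).congr_left fun t => ?_
    ring
  have h1 := hnum.tendsto_div_nhds_zero.add_const G
  rw [zero_add] at h1
  refine h1.congr' ?_
  filter_upwards [hA0] with t ht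
  rw [gaussScheme]
  field_simp
  ring

/-! ### Umbilical points -/

open Asymptotics in
-- With D = 0 every normal curvature is H, so the defect is H² S_p and the cotangent vector 4 H S_p
-- ν to second order. As H²(2A − S_p) + 2(S_p − A)H² = H² S_p, the value of A plays no role beyond
-- its size.
theorem tendsto_gaussScheme_of_umbilic {ι : Type*} {n : ℕ} [NeZero n] {S : Set E3} {F : E2 → E3}
    {u : E2} {Z : E3 →L[ℝ] ℂ} {H : ℝ} {l : Filter ι} {P : ι → ZMod n → E3}
    (h : IsShrinkingFamily S F u Z H 0 l P) {c : ℝ} (hc : 0 < c)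
    (hN : ∀ᶠ t in l, IsNondegenerate c (F u) (P t)) :
    Tendsto (fun t => gaussScheme (F u) (P t)) l (𝓝 (H ^ 2)) := by
  have hsin : ∀ᶠ t in l, ∀ i, c ≤ Real.sin (gammaAngle (F u) (P t) i) :=
    hN.mono fun t ht => ht.sin_gamma
  have hs0 : ∀ᶠ t in l, ∀ i, 0 < Real.sin (gammaAngle (F u) (P t) i) :=
    hsin.mono fun t ht i => hc.trans_le (ht i)
  have hg : ∀ t i, curvElevation H 0 Z (F u) (P t) i = H * edgeLength (F u) (P t) i / 2 := by
    intro t i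
    simp [curvElevation, normalCurv]
  -- Cauchy–Schwarz bounds δ² by n times the sum of the η_i², and nondegeneracy bounds each of these
  -- n terms by |f| / c.
  have hlen : ∀ {f : ι → ℝ}, (∀ᶠ t in l, ∀ i, c * edgeLength (F u) (P t) i ^ 2 ≤ |f t|) →
      (fun t => totalLength (F u) (P t) ^ 2) =O[l] f := by
    intro f hf
    refine isBigO_const_mul_of_abs_le (n * (n * c⁻¹)) ?_
    filter_upwards [hf] with t ht
    rw [abs_of_nonneg (sq_nonneg _)]
    have h1 := sq_sum_le_card_mul_sum_sq (s := (Finset.univ : Finset (ZMod n)))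
      (f := fun i => edgeLength (F u) (P t) i)
    rw [Finset.card_univ, ZMod.card] at h1
    have h2 : ∑ i : ZMod n, edgeLength (F u) (P t) i ^ 2 ≤ n * (c⁻¹ * |f t|) := by
      have h3 := Finset.sum_le_card_nsmul Finset.univ (fun i => edgeLength (F u) (P t) i ^ 2)
        (c⁻¹ * |f t|) fun i _ => by rw [← div_eq_inv_mul, le_div_iff₀ hc, mul_comm]; exact ht i
      rwa [Finset.card_univ, ZMod.card, nsmul_eq_mul] at h3
    calc totalLength (F u) (P t) ^ 2 ≤ n * ∑ i : ZMod n, edgeLength (F u) (P t) i ^ 2 := h1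
      _ ≤ n * (n * (c⁻¹ * |f t|)) := by gcongr
      _ = _ := by ring
  refine tendsto_gaussScheme (ν := unitNormal F u) (H := H)
    (δ := fun t => totalLength (F u) (P t)) ?_ (h.ring.mono fun t ht => ht.ne h.coord) hs0
    h.eventually_totalLength_pos (IsShrinkingFamily.meshModule_isBigO hc hsin)
    (IsShrinkingFamily.trigSum_isBigO hc hsin)
    (hlen (hN.mono fun t ht => ht.module)) (hlen (hN.mono fun t ht => ht.denominator)) ?_ ?_
  · rw [← sq_eq_sq₀ (norm_nonneg _) zero_le_one, ← real_inner_self_eq_norm_sq,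
      h.coord.inner_self, one_pow]
  · refine (h.angularDefect_sub_isLittleO hc hsin).congr' ?_ (EventuallyEq.refl _ _)
    filter_upwards [hs0] with t ht
    have h1 : H ^ 2 * (2 * trigSum (F u) (P t) - meshModule (F u) (P t)) +
        2 * (meshModule (F u) (P t) - trigSum (F u) (P t)) * H ^ 2 =
        H ^ 2 * meshModule (F u) (P t) := by ring
    rw [h1, meshModule_eq_sum, Finset.mul_sum]
    congr 1
    refine Finset.sum_congr rfl fun i _ => ?_
    have h2 := (ht i).ne'
    rw [hg, hg]
    field_simp
    ring
  · refine (h.sum_cotWeight_sub_isLittleO hc hsin).congr' ?_ (EventuallyEq.refl _ _)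
    filter_upwards [hs0] with t ht
    congr 2
    rw [meshModule_eq_sum, Finset.mul_sum]
    refine Finset.sum_congr rfl fun i _ => ?_
    have h2 := (ht i).ne'
    rw [hg, hg]
    field_simp
    ring

/-! ### Sums over regular polygons -/

section Cyclic

variable {n : ℕ} [NeZero n] {x : ZMod n → ℂ} {q : ℂ}

/-- Shifting the index leaves the sum unchanged but multiplies it by q. -/
theorem sum_eq_zero_of_cyclic (hx : ∀ i, x (i + 1) = x i * q) (hq : q ≠ 1) : ∑ i, x i = 0 := by
  have h1 : ∑ i, x i = (∑ i, x i) * q := by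
    rw [Finset.sum_mul, ← Equiv.sum_comp (Equiv.addRight (1 : ZMod n)) x]
    exact Finset.sum_congr rfl fun i _ => hx i
  have h2 : (∑ i, x i) * (q - 1) = 0 := by linear_combination -h1
  exact (mul_eq_zero.1 h2).resolve_right (sub_ne_zero.2 hq)

theorem sum_re_eq_zero_of_cyclic (hx : ∀ i, x (i + 1) = x i * q) (hq : q ≠ 1) :
    ∑ i, (x i).re = 0 := by
  rw [← Complex.re_sum, sum_eq_zero_of_cyclic hx hq, Complex.zero_re]

/-- Re x · Re(xq) is half of Re(x²q) + |x|² Re q, and the squares x_i² form a cyclic progression of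
ratio q², so they sum to zero. -/
theorem sum_re_mul_re_of_cyclic {r : ℝ} (hx : ∀ i, x (i + 1) = x i * q) (hq : q ^ 2 ≠ 1)
    (hr : ∀ i, ‖x i‖ = r) : ∑ i, (x i).re * (x (i + 1)).re = n * (r ^ 2 * q.re / 2) := by
  have h1 : ∑ i, x i ^ 2 = 0 :=
    sum_eq_zero_of_cyclic (q := q ^ 2) (fun i => by rw [hx, mul_pow]) hq
  have h2 : ∀ i, (x i).re * (x (i + 1)).re = (x i ^ 2 * (q / 2)).re + r ^ 2 * q.re / 2 := by
    intro i
    rw [hx, ← hr i, Complex.sq_norm, Complex.normSq_apply]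
    simp [pow_two]
    ring
  simp only [h2]
  rw [Finset.sum_add_distrib, ← Complex.re_sum, ← Finset.sum_mul, h1]
  simp [ZMod.card]

theorem sum_re_sq_of_cyclic {r : ℝ} (hx : ∀ i, x (i + 1) = x i * q) (hq : q ^ 2 ≠ 1)
    (hr : ∀ i, ‖x i‖ = r) : ∑ i, (x i).re ^ 2 = n * (r ^ 2 / 2) := by
  have h1 : ∑ i, x i ^ 2 = 0 :=
    sum_eq_zero_of_cyclic (q := q ^ 2) (fun i => by rw [hx, mul_pow]) hq
  have h2 : ∀ i, (x i).re ^ 2 = (x i ^ 2 * (1 / 2)).re + r ^ 2 / 2 := by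
    intro i
    rw [← hr i, Complex.sq_norm, Complex.normSq_apply]
    simp [pow_two]
    ring
  simp only [h2]
  rw [Finset.sum_add_distrib, ← Complex.re_sum, ← Finset.sum_mul, h1]
  simp [ZMod.card]

end Cyclic

theorem two_pi_div_mem_of_five_le {n : ℕ} (hn : 5 ≤ n) :
    0 < 2 * Real.pi / n ∧ 2 * Real.pi / n * 4 < 2 * Real.pi := by
  have h1 : (5 : ℝ) ≤ n := by exact_mod_cast hn
  have h2 := Real.pi_pos
  refine ⟨by positivity, ?_⟩
  rw [div_mul_eq_mul_div, div_lt_iff₀ (by linarith)]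
  nlinarith

theorem cos_ne_one_of_mem {x : ℝ} (h0 : 0 < x) (h1 : x < 2 * Real.pi) : Real.cos x ≠ 1 := by
  intro h
  exact h0.ne' ((Real.cos_eq_one_iff_of_lt_of_lt (by linarith) h1).1 h)

/-- The unit complex number with real part `cos (2b)`, `b = 2π/n`, `n ≥ 5`, is neither `1` nor
`-1`. -/
theorem ne_one_and_sq_ne_one {n : ℕ} (hn : 5 ≤ n) {q : ℂ} (hq : ‖q‖ = 1)
    (hre : q.re = Real.cos (2 * (2 * Real.pi / n))) : q ≠ 1 ∧ q ^ 2 ≠ 1 := by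
  obtain ⟨h0, h4⟩ := two_pi_div_mem_of_five_le hn
  set b := 2 * Real.pi / n
  constructor
  · rintro rfl
    exact cos_ne_one_of_mem (by linarith) (by linarith) hre.symm
  · intro h
    -- Here n ≥ 5 is needed in full: 4b < 2π, whereas n = 4 gives q² = 1.
    have h1 : (q ^ 2).re = Real.cos (b * 4) := by
      have h2 : b * 4 = 2 * (2 * b) := by ring
      have h3 : q.re * q.re + q.im * q.im = 1 := by
        rw [← Complex.normSq_apply, ← Complex.sq_norm, hq, one_pow]
      rw [h2, Real.cos_two_mul, ← hre, pow_two, Complex.mul_re]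
      linarith
    rw [h, Complex.one_re] at h1
    exact cos_ne_one_of_mem (by linarith) h4 h1.symm

/-- The limit of the trigonometric sum for a regular one-ring of unit size. -/
theorem sum_trig_regular {n : ℕ} (hn : 5 ≤ n) :
    ∑ i ∈ Finset.Icc 1 n, 1 / (4 * Real.sin (2 * Real.pi / n)) *
      (1 / 2 * (1 - Real.cos (2 * (i * (2 * Real.pi / n))) *
          Real.cos (2 * ((i + 1 : ℕ) * (2 * Real.pi / n)))) -
        Real.cos (2 * Real.pi / n) / 4 * (Real.sin (i * (2 * Real.pi / n)) ^ 2 +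
          Real.sin ((i + 1 : ℕ) * (2 * Real.pi / n)) ^ 2)) =
    n / (4 * Real.sin (2 * Real.pi / n)) * (1 / 2 - Real.cos (2 * (2 * Real.pi / n)) / 4 -
      Real.cos (2 * Real.pi / n) / 4) := by
  have : NeZero n := ⟨by omega⟩
  set b := 2 * Real.pi / n with hb
  -- The squared standard character interpolates e^{2ijb}, so the index n + 1 wraps around by
  -- itself.
  set x : ZMod n → ℂ := fun i => ZMod.stdAddChar i ^ 2 with hx
  have hxj : ∀ j : ℕ, (x (j : ZMod n)).re = Real.cos (2 * (j * b)) := fun j => by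
    have h1 : x (j : ZMod n) = Complex.exp ((2 * (j * b) : ℝ) * Complex.I) := by
      have h2 := ZMod.stdAddChar_coe (N := n) (j : ℤ)
      simp only [Int.cast_natCast] at h2
      simp only [hx]
      rw [h2, ← Complex.exp_nat_mul, hb]
      congr 1
      push_cast
      ring
    rw [h1, Complex.exp_ofReal_mul_I_re]
  set q : ℂ := x 1 with hq
  have hxq : ∀ i, x (i + 1) = x i * q := fun i => by
    simp only [hx, hq, AddChar.map_add_eq_mul, mul_pow]
  have hnorm : ∀ i, ‖x i‖ = 1 := fun i => by simp [hx]
  have hqre : q.re = Real.cos (2 * b) := by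
    have := hxj 1
    simpa using this
  obtain ⟨hq1, hq2⟩ := ne_one_and_sq_ne_one hn (hnorm 1) hqre
  have hsum1 := sum_re_eq_zero_of_cyclic hxq hq1
  have hsum1' : ∑ i, (x (i + 1)).re = 0 := by
    rw [← hsum1]
    exact Equiv.sum_comp (Equiv.addRight (1 : ZMod n)) fun i => (x i).re
  have hsum2 := sum_re_mul_re_of_cyclic hxq hq2 hnorm
  rw [hqre] at hsum2
  obtain ⟨g, hg⟩ : ∃ g : ZMod n → ℝ, ∀ k, g k = 1 / (4 * Real.sin b) *
      (1 / 2 * (1 - (x k).re * (x (k + 1)).re) -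
        Real.cos b / 4 * ((1 - (x k).re) / 2 + (1 - (x (k + 1)).re) / 2)) := ⟨_, fun _ => rfl⟩
  have hterm : ∀ i : ℕ, 1 / (4 * Real.sin b) *
      (1 / 2 * (1 - Real.cos (2 * (i * b)) * Real.cos (2 * ((i + 1 : ℕ) * b))) -
        Real.cos b / 4 * (Real.sin (i * b) ^ 2 + Real.sin ((i + 1 : ℕ) * b) ^ 2)) =
      g (i : ZMod n) := by
    intro i
    have h1 := hxj i
    have h2 := hxj (i + 1)
    rw [Nat.cast_add, Nat.cast_one] at h2
    rw [hg, h1, h2, Nat.cast_add_one, Real.sin_sq_eq_half_sub, Real.sin_sq_eq_half_sub]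
    ring
  rw [Finset.sum_congr rfl fun i _ => hterm i, ZMod.sum_Icc_natCast g]
  simp only [hg]
  rw [← Finset.mul_sum, Finset.sum_sub_distrib, ← Finset.mul_sum,
    ← Finset.mul_sum, Finset.sum_sub_distrib, hsum2, Finset.sum_add_distrib, ← Finset.sum_div,
    ← Finset.sum_div, Finset.sum_sub_distrib, Finset.sum_sub_distrib, hsum1, hsum1']
  simp only [Finset.sum_const, Finset.card_univ, ZMod.card, nsmul_eq_mul]
  ring

/-- In a regular one-ring the tangential directions are the successive powers of a rotation. -/
theorem IsOneRing.exists_rotation {Z : E3 →L[ℝ] ℂ} {n : ℕ} {S : Set E3} {F : E2 → E3} {u : E2}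
    {P : ZMod n → E3} (hP : IsOneRing S F u P) (h : IsTangentCoord Z (unitNormal F u)) {b : ℝ}
    (hb : 0 ≤ Real.sin b) (hβ : ∀ i, betaAngle F u P i = b) :
    ∃ ω : ℂ, ‖ω‖ = 1 ∧ ω.re = Real.cos b ∧ ∀ i,
      tangentDir Z (F u) P (i + 1) / ‖tangentDir Z (F u) P (i + 1)‖ =
        tangentDir Z (F u) P i / ‖tangentDir Z (F u) P i‖ * ω := by
  obtain ⟨σ, hσ, hσ'⟩ := hP.exists_sign h
  -- ω = e^{iσb}. The cosine comes from β = b; the sine is known up to sign from the modulus, and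
  -- the orientation σ fixes the sign.
  refine ⟨⟨Real.cos b, σ * Real.sin b⟩, ?_, rfl, fun i => ?_⟩
  · rw [← sq_eq_sq₀ (norm_nonneg _) zero_le_one, Complex.sq_norm, Complex.normSq_apply]
    linear_combination Real.sin_sq_add_cos_sq b + Real.sin b ^ 2 * hσ
  · set a := tangentDir Z (F u) P i
    set a' := tangentDir Z (F u) P (i + 1)
    have ha : 0 < ‖a‖ := norm_pos_iff.2 (hP.tangentDir_ne_zero h i)
    have ha' : 0 < ‖a'‖ := norm_pos_iff.2 (hP.tangentDir_ne_zero h (i + 1))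
    have hre : ‖a‖ * ‖a'‖ * Real.cos b = (starRingEnd ℂ a * a').re := by
      rw [← hβ i]; exact hP.cos_betaAngle h i
    have him : 0 < σ * (starRingEnd ℂ a * a').im := hσ' i
    have hns : (starRingEnd ℂ a * a').re ^ 2 + (starRingEnd ℂ a * a').im ^ 2 =
        (‖a‖ * ‖a'‖) ^ 2 := by
      have h1 : ‖starRingEnd ℂ a * a'‖ ^ 2 = (‖a‖ * ‖a'‖) ^ 2 := by
        rw [norm_mul, RCLike.norm_conj]
      rw [← h1, Complex.sq_norm, Complex.normSq_apply]
      ring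
    have him' : σ * (starRingEnd ℂ a * a').im = ‖a‖ * ‖a'‖ * Real.sin b := by
      rw [← sq_eq_sq₀ him.le (by positivity), mul_pow, hσ]
      rw [← hre] at hns
      linear_combination hns - (‖a‖ * ‖a'‖) ^ 2 * Real.sin_sq_add_cos_sq b
    have hprod : starRingEnd ℂ a * a' =
        ((‖a‖ * ‖a'‖ : ℝ) : ℂ) * ⟨Real.cos b, σ * Real.sin b⟩ := by
      apply Complex.ext
      · rw [Complex.re_ofReal_mul]; exact hre.symm
      · rw [Complex.im_ofReal_mul]
        linear_combination σ * him' - (starRingEnd ℂ a * a').im * hσ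
    have haa : a * starRingEnd ℂ a = (‖a‖ : ℂ) ^ 2 := by
      rw [Complex.mul_conj, ← Complex.sq_norm]; push_cast; ring
    have h1 : (‖a‖ : ℂ) ≠ 0 := by exact_mod_cast ha.ne'
    have h2 : (‖a'‖ : ℂ) ≠ 0 := by exact_mod_cast ha'.ne'
    push_cast at hprod
    rw [div_mul_eq_mul_div, div_eq_div_iff h2 h1]
    apply mul_left_cancel₀ h1
    linear_combination a * hprod - a' * haa

/-- Sums of normal curvatures over a regular one-ring. -/
theorem IsOneRing.sum_normalCurv {Z : E3 →L[ℝ] ℂ} {n : ℕ} [NeZero n] (hn : 5 ≤ n) {S : Set E3}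
    {F : E2 → E3} {u : E2} {P : ZMod n → E3} (hP : IsOneRing S F u P)
    (h : IsTangentCoord Z (unitNormal F u)) (hβ : ∀ i, betaAngle F u P i = 2 * Real.pi / n)
    (H : ℝ) (D : ℂ) :
    (∑ i, normalCurv H D (tangentDir Z (F u) P i) = n * H) ∧
    (∑ i, normalCurv H D (tangentDir Z (F u) P i) ^ 2 = n * (H ^ 2 + ‖D‖ ^ 2 / 2)) ∧
    (∑ i, normalCurv H D (tangentDir Z (F u) P i) * normalCurv H D (tangentDir Z (F u) P (i + 1)) =
      n * (H ^ 2 + ‖D‖ ^ 2 * Real.cos (2 * (2 * Real.pi / n)) / 2)) := by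
  obtain ⟨h0, h4⟩ := two_pi_div_mem_of_five_le hn
  obtain ⟨ω, hω, hωre, hrot⟩ := hP.exists_rotation h
    (Real.sin_nonneg_of_nonneg_of_le_pi h0.le (by linarith)) hβ
  -- κ_i = H + Re x_i, where the x_i have modulus ‖D‖ and form a cyclic progression of ratio ω².
  set x : ZMod n → ℂ := fun i => D * (tangentDir Z (F u) P i / ‖tangentDir Z (F u) P i‖) ^ 2
    with hx
  have hκ : ∀ i, normalCurv H D (tangentDir Z (F u) P i) = H + (x i).re := fun i => rfl
  have hxq : ∀ i, x (i + 1) = x i * ω ^ 2 := fun i => by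
    simp only [hx, hrot]; ring
  have hnorm : ∀ i, ‖x i‖ = ‖D‖ := fun i => by
    have h1 := norm_ne_zero_iff.2 (hP.tangentDir_ne_zero h i)
    simp only [hx]
    rw [norm_mul, norm_pow, norm_div, Complex.norm_real, norm_norm, div_self h1, one_pow, mul_one]
  have hq : ‖ω ^ 2‖ = 1 := by rw [norm_pow, hω, one_pow]
  have hqre : (ω ^ 2).re = Real.cos (2 * (2 * Real.pi / n)) := by
    have h3 : ω.re * ω.re + ω.im * ω.im = 1 := by
      rw [← Complex.normSq_apply, ← Complex.sq_norm, hω, one_pow]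
    rw [Real.cos_two_mul, ← hωre, pow_two, Complex.mul_re]
    linarith
  obtain ⟨hq1, hq2⟩ := ne_one_and_sq_ne_one hn hq hqre
  have e1 := sum_re_eq_zero_of_cyclic hxq hq1
  have e1' : ∑ i, (x (i + 1)).re = 0 := by
    rw [← e1]
    exact Equiv.sum_comp (Equiv.addRight (1 : ZMod n)) fun i => (x i).re
  have e2 := sum_re_sq_of_cyclic hxq hq2 hnorm
  have e3 := sum_re_mul_re_of_cyclic hxq hq2 hnorm
  rw [hqre] at e3
  simp only [hκ]
  refine ⟨?_, ?_, ?_⟩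
  · rw [Finset.sum_add_distrib, e1]
    simp [ZMod.card]
  · have h5 : ∀ i, (H + (x i).re) ^ 2 = H ^ 2 + 2 * H * (x i).re + (x i).re ^ 2 :=
      fun i => by ring
    simp only [h5]
    rw [Finset.sum_add_distrib, Finset.sum_add_distrib, ← Finset.mul_sum, e1, e2]
    simp [ZMod.card]
    ring
  · have h5 : ∀ i, (H + (x i).re) * (H + (x (i + 1)).re) =
        H ^ 2 + H * (x i).re + H * (x (i + 1)).re + (x i).re * (x (i + 1)).re :=
      fun i => by ring
    simp only [h5]
    rw [Finset.sum_add_distrib, Finset.sum_add_distrib, Finset.sum_add_distrib, ← Finset.mul_sum,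
      ← Finset.mul_sum, e1, e1', e3]
    simp [ZMod.card]
    ring

/-! ### Regular vertices -/

open Asymptotics in
/-- Along shrinking one-rings whose projected angles are all `b`, the angles tend to `b`. -/
theorem IsShrinkingFamily.tendsto_gammaAngle {ι : Type*} {n : ℕ} [NeZero n] {S : Set E3}
    {F : E2 → E3} {u : E2} {Z : E3 →L[ℝ] ℂ} {H : ℝ} {D : ℂ} {l : Filter ι}
    {P : ι → ZMod n → E3} (h : IsShrinkingFamily S F u Z H D l P) {b : ℝ}
    (hβ : ∀ᶠ t in l, ∀ i, betaAngle F u (P t) i = b) (hb : b ∈ Set.Icc 0 Real.pi) (i : ZMod n) :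
    Tendsto (fun t => gammaAngle (F u) (P t) i) l (𝓝 b) := by
  have hs : ∀ j, Tendsto (fun t => elevation (unitNormal F u) (F u) (P t) j) l (𝓝 0) := by
    intro j
    have h1 : (fun t => elevation (unitNormal F u) (F u) (P t) j) =O[l]
        fun t => totalLength (F u) (P t) := by
      simpa using (h.elevation_sub_isLittleO j).isBigO.add
        (curvElevation_isBigO (H := H) (D := D) (Z := Z) j)
    exact h1.trans_tendsto h.tendsto_totalLength
  have hsq : ∀ j, Tendsto (fun t => √(1 - elevation (unitNormal F u) (F u) (P t) j ^ 2)) l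
      (𝓝 1) := by
    intro j
    have := (((hs j).pow 2).const_sub 1).sqrt
    simpa using this
  have hcos : Tendsto (fun t => Real.cos (gammaAngle (F u) (P t) i)) l (𝓝 (Real.cos b)) := by
    have h1 := (((hsq i).mul (hsq (i + 1))).mul_const (Real.cos b)).add ((hs i).mul (hs (i + 1)))
    simp only [mul_one, one_mul, mul_zero, add_zero] at h1
    refine h1.congr' ?_
    filter_upwards [h.ring, hβ] with t ht htb
    rw [ht.cos_gammaAngle_eq h.coord i, htb i]
  have h1 := (Real.continuous_arccos.tendsto _).comp hcos
  rw [Real.arccos_cos hb.1 hb.2] at h1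
  refine h1.congr fun t => ?_
  exact Real.arccos_cos (gammaAngle_mem i).1 (gammaAngle_mem i).2

/-- A sum of bounded quantities with converging coefficients, of which the limiting combination
is constant. -/
theorem tendsto_sum_mul_of_bounded {ι κ : Type*} [Fintype κ] {l : Filter ι} {f g : ι → κ → ℝ}
    {a B L : ℝ} (hf : ∀ i, Tendsto (fun t => f t i) l (𝓝 a)) (hg : ∀ t i, |g t i| ≤ B)
    (hsum : ∀ᶠ t in l, a * ∑ i, g t i = L) :
    Tendsto (fun t => ∑ i, f t i * g t i) l (𝓝 L) := by
  -- The individual g may oscillate; freezing the coefficients at a costs o(1) times a bounded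
  -- quantity, and the frozen sum is L.
  have h1 : Tendsto (fun t => ∑ i, (f t i - a) * g t i) l (𝓝 0) := by
    have h2 : ∀ i, Tendsto (fun t => (f t i - a) * g t i) l (𝓝 0) := fun i => by
      have h3 : Tendsto (fun t => f t i - a) l (𝓝 0) := by simpa using (hf i).sub_const a
      exact h3.zero_mul_isBoundedUnder_le
        (isBoundedUnder_of ⟨B, fun t => by simpa using hg t i⟩)
    simpa using tendsto_finsetSum Finset.univ fun i _ => h2 i
  have h2 := h1.add_const L
  rw [zero_add] at h2
  refine h2.congr' ?_
  filter_upwards [hsum] with t ht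
  rw [← ht, Finset.mul_sum, ← Finset.sum_add_distrib]
  exact Finset.sum_congr rfl fun i _ => by ring

open Asymptotics in
-- After division by the squared common edge length, the module, the trigonometric sum and the
-- defect all converge. The polygon sums turn the defect into H² S_p − ‖D‖²(2A − S_p), which is the
-- combination required by `tendsto_gaussScheme` for G = H² − ‖D‖².
theorem tendsto_gaussScheme_of_regular {ι : Type*} {n : ℕ} [NeZero n] (hn : 5 ≤ n) {S : Set E3}
    {F : E2 → E3} {u : E2} {Z : E3 →L[ℝ] ℂ} {H : ℝ} {D : ℂ} {l : Filter ι}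
    {P : ι → ZMod n → E3} (h : IsShrinkingFamily S F u Z H D l P)
    (hreg : ∀ᶠ t in l, IsRegularVertex F u (P t)) :
    Tendsto (fun t => gaussScheme (F u) (P t)) l (𝓝 (H ^ 2 - ‖D‖ ^ 2)) := by
  obtain ⟨hb0, hb4⟩ := two_pi_div_mem_of_five_le hn
  have hβ : ∀ᶠ t in l, ∀ i, betaAngle F u (P t) i = 2 * Real.pi / n :=
    hreg.mono fun t ht => ht.angles
  have hπ := Real.pi_pos
  have hγ : ∀ i, Tendsto (fun t => gammaAngle (F u) (P t) i) l (𝓝 (2 * Real.pi / n)) :=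
    h.tendsto_gammaAngle hβ ⟨hb0.le, by linarith⟩
  have hnpos : (0 : ℝ) < n := by exact_mod_cast (by omega : 0 < n)
  have htrig := sum_trig_regular hn
  have hκsum : ∀ᶠ t in l, _ := h.ring.and hβ |>.mono fun t ht =>
    ht.1.sum_normalCurv hn h.coord ht.2 H D
  set b := 2 * Real.pi / n with hb
  have hsb : 0 < Real.sin b := Real.sin_pos_of_pos_of_lt_pi hb0 (by linarith)
  -- n ≥ 5 puts b below π/2; this makes 1 + 2 cos b, a factor of the limiting denominator, positive.
  have hcb : 0 < Real.cos b := Real.cos_pos_of_mem_Ioo ⟨by linarith, by linarith⟩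
  have hcb1 : Real.cos b < 1 :=
    lt_of_le_of_ne (Real.cos_le_one b) (cos_ne_one_of_mem hb0 (by linarith))
  have hsinγ : ∀ i, Tendsto (fun t => Real.sin (gammaAngle (F u) (P t) i)) l (𝓝 (Real.sin b)) :=
    fun i => (Real.continuous_sin.tendsto _).comp (hγ i)
  have hcosγ : ∀ i, Tendsto (fun t => Real.cos (gammaAngle (F u) (P t) i)) l (𝓝 (Real.cos b)) :=
    fun i => (Real.continuous_cos.tendsto _).comp (hγ i)
  -- The sines of the γ_i tend to sin b > 0, so half of it is an eventual lower bound: nondegeneracy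
  -- is automatic here.
  have hc : 0 < Real.sin b / 2 := by linarith
  have hsin : ∀ᶠ t in l, ∀ i, Real.sin b / 2 ≤ Real.sin (gammaAngle (F u) (P t) i) :=
    eventually_all.2 fun i => (hsinγ i).eventually (le_mem_nhds (by linarith))
  have hs0 : ∀ᶠ t in l, ∀ i, 0 < Real.sin (gammaAngle (F u) (P t) i) :=
    hsin.mono fun t ht i => hc.trans_le (ht i)
  -- common edge length
  set η := fun t => edgeLength (F u) (P t) 0 with hη
  have hlen : ∀ᶠ t in l, ∀ i, edgeLength (F u) (P t) i = η t :=
    hreg.mono fun t ht i => ht.lengths i 0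
  have hδη : ∀ᶠ t in l, totalLength (F u) (P t) = n * η t := by
    filter_upwards [hlen] with t ht
    simp [totalLength, ht, ZMod.card]
  -- the mesh module
  set S' := fun t => ∑ i : ZMod n, 1 / (4 * Real.sin (gammaAngle (F u) (P t) i)) *
    (1 - Real.cos (gammaAngle (F u) (P t) i)) with hS'
  have hSη : ∀ᶠ t in l, meshModule (F u) (P t) = η t ^ 2 * S' t := by
    filter_upwards [hlen] with t ht
    rw [meshModule_eq_sum, hS', Finset.mul_sum]
    refine Finset.sum_congr rfl fun i _ => ?_
    rw [ht, ht]
    ring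
  have hinv : ∀ i, Tendsto (fun t => 1 / (4 * Real.sin (gammaAngle (F u) (P t) i))) l
      (𝓝 (1 / (4 * Real.sin b))) := fun i =>
    tendsto_const_nhds.div ((hsinγ i).const_mul 4) (by positivity)
  have hS'lim : Tendsto S' l (𝓝 (n / (4 * Real.sin b) * (1 - Real.cos b))) := by
    have h1 := tendsto_finsetSum (Finset.univ : Finset (ZMod n)) fun i _ =>
      (hinv i).mul ((hcosγ i).const_sub 1)
    simp only [Finset.sum_const, Finset.card_univ, ZMod.card, nsmul_eq_mul] at h1
    convert h1 using 2
    ring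
  -- the trigonometric sum
  have hφ : ∀ j : ℕ, Tendsto (fun t => phiAngle (F u) (P t) j) l (𝓝 (j * b)) := fun j => by
    have h1 := tendsto_finsetSum (Finset.Icc 1 j) fun (i : ℕ) _ => hγ (i : ZMod n)
    simpa [phiAngle] using h1
  set A' := fun t => ∑ i ∈ Finset.Icc 1 n,
    1 / (4 * Real.sin (gammaAngle (F u) (P t) (i : ZMod n))) *
      (1 / 2 * (1 - Real.cos (2 * phiAngle (F u) (P t) i) *
          Real.cos (2 * phiAngle (F u) (P t) (i + 1))) -
        Real.cos (gammaAngle (F u) (P t) (i : ZMod n)) / 4 *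
          (Real.sin (phiAngle (F u) (P t) i) ^ 2 + Real.sin (phiAngle (F u) (P t) (i + 1)) ^ 2))
    with hA'
  have hAη : ∀ᶠ t in l, trigSum (F u) (P t) = η t ^ 2 * A' t := by
    filter_upwards [hlen] with t ht
    rw [trigSum, hA', Finset.mul_sum]
    refine Finset.sum_congr rfl fun i _ => ?_
    rw [ht, ht]
    ring
  have hA'lim : Tendsto A' l (𝓝 (n / (4 * Real.sin b) *
      (1 / 2 - Real.cos (2 * b) / 4 - Real.cos b / 4))) := by
    rw [← htrig]
    refine tendsto_finsetSum _ fun i _ => (hinv i).mul (Tendsto.sub (Tendsto.const_mul _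
      (Tendsto.const_sub _ (Tendsto.mul ?_ ?_)))
      (((hcosγ i).div_const 4).mul (Tendsto.add (Tendsto.pow ?_ 2) (Tendsto.pow ?_ 2))))
    · exact (Real.continuous_cos.tendsto _).comp ((hφ i).const_mul 2)
    · exact (Real.continuous_cos.tendsto _).comp ((hφ (i + 1)).const_mul 2)
    · exact (Real.continuous_sin.tendsto _).comp (hφ i)
    · exact (Real.continuous_sin.tendsto _).comp (hφ (i + 1))
  -- expansions
  have hK : ∀ t i, |normalCurv H D (tangentDir Z (F u) (P t) i)| ≤ |H| + ‖D‖ := fun t i =>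
    abs_normalCurv_le _ _ _
  set κ := fun t i => normalCurv H D (tangentDir Z (F u) (P t) i) with hκ
  have hg : ∀ᶠ t in l, ∀ i, curvElevation H D Z (F u) (P t) i = κ t i * η t / 2 := by
    filter_upwards [hlen] with t ht i
    rw [curvElevation, ht]
  have hKK : ∀ t i j, |κ t i * κ t j| ≤ (|H| + ‖D‖) ^ 2 := fun t i j => by
    rw [abs_mul, pow_two]
    exact mul_le_mul (hK t i) (hK t j) (abs_nonneg _) (by positivity)
  have hshift : ∀ (t : ι) (f : ℝ → ℝ), ∑ i, f (κ t (i + 1)) = ∑ i, f (κ t i) := fun t f =>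
    Equiv.sum_comp (Equiv.addRight (1 : ZMod n)) fun i => f (κ t i)
  have hη2 : ∀ {f : ι → ℝ}, Tendsto f l (𝓝 0) → (fun t => η t ^ 2 * f t) =o[l]
      fun t => totalLength (F u) (P t) ^ 2 := by
    intro f hf
    have h1 := (IsShrinkingFamily.edge_mul_edge_isBigO (P := P) (l := l) (F u) 0 0).mul_isLittleO
      ((isLittleO_one_iff ℝ).2 hf)
    simpa only [pow_two, mul_one] using h1
  have hδO : ∀ {f g : ι → ℝ} {L : ℝ}, L ≠ 0 → Tendsto g l (𝓝 L) →
      (∀ᶠ t in l, f t = η t ^ 2 * g t) → (fun t => totalLength (F u) (P t) ^ 2) =O[l] f := by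
    intro f g L hL hgL hf
    have h1 : (fun t => (g t)⁻¹) =O[l] fun _ => (1 : ℝ) := (hgL.inv₀ hL).isBigO_one ℝ
    have h2 := ((isBigO_refl f l).mul h1).const_mul_left ((n : ℝ) ^ 2)
    simp only [mul_one] at h2
    refine h2.congr' ?_ (EventuallyEq.refl _ _)
    filter_upwards [hf, hδη, hgL.eventually_ne hL] with t ht htn hg0
    rw [ht, htn]
    field_simp
  have hc2 : Real.cos (2 * b) = 2 * Real.cos b ^ 2 - 1 := Real.cos_two_mul b
  refine tendsto_gaussScheme (ν := unitNormal F u) (H := H)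
    (δ := fun t => totalLength (F u) (P t)) ?_ (h.ring.mono fun t ht => ht.ne h.coord) hs0
    h.eventually_totalLength_pos (IsShrinkingFamily.meshModule_isBigO hc hsin)
    (IsShrinkingFamily.trigSum_isBigO hc hsin) (hδO ?_ hS'lim hSη)
    (hδO ?_ ((hA'lim.const_mul 2).sub hS'lim) ?_) ?_ ?_
  · rw [← sq_eq_sq₀ (norm_nonneg _) zero_le_one, ← real_inner_self_eq_norm_sq,
      h.coord.inner_self, one_pow]
  · have : 0 < 1 - Real.cos b := by linarith
    positivity
  · have h1 : 2 * (n / (4 * Real.sin b) * (1 / 2 - Real.cos (2 * b) / 4 - Real.cos b / 4)) -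
        n / (4 * Real.sin b) * (1 - Real.cos b) =
        n / (4 * Real.sin b) * ((1 - Real.cos b) * (1 + 2 * Real.cos b) / 2) := by
      rw [hc2]; ring
    have : 0 < 1 - Real.cos b := by linarith
    rw [h1]
    positivity
  · filter_upwards [hSη, hAη] with t h1 h2
    rw [h1, h2]
    ring
  · set f₁ := fun t => ∑ i : ZMod n, 1 / (4 * Real.sin (gammaAngle (F u) (P t) i)) *
      (κ t i * κ t (i + 1)) with hf₁
    set f₂ := fun t => ∑ i : ZMod n, 1 / (4 * Real.sin (gammaAngle (F u) (P t) i)) *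
      (Real.cos (gammaAngle (F u) (P t) i) / 2) * (κ t i ^ 2 + κ t (i + 1) ^ 2) with hf₂
    have h1 : Tendsto f₁ l (𝓝 (1 / (4 * Real.sin b) *
        (n * (H ^ 2 + ‖D‖ ^ 2 * Real.cos (2 * b) / 2)))) := by
      refine tendsto_sum_mul_of_bounded hinv (fun t i => hKK t i (i + 1)) ?_
      filter_upwards [hκsum] with t ht
      rw [ht.2.2]
    have h2 : Tendsto f₂ l (𝓝 (1 / (4 * Real.sin b) * (Real.cos b / 2) *
        (2 * (n * (H ^ 2 + ‖D‖ ^ 2 / 2))))) := by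
      refine tendsto_sum_mul_of_bounded (B := 2 * (|H| + ‖D‖) ^ 2)
        (fun i => (hinv i).mul ((hcosγ i).div_const 2)) (fun t i => ?_) ?_
      · refine (abs_add_le _ _).trans ?_
        have e1 := hKK t i i
        have e2 := hKK t (i + 1) (i + 1)
        rw [pow_two (κ t i), pow_two (κ t (i + 1))]
        linarith
      · filter_upwards [hκsum] with t ht
        rw [Finset.sum_add_distrib, hshift t fun x => x ^ 2, ht.2.1]
        ring
    -- The limit of (2A − S_p)/η² is n/(4 sin b) · (cos b − cos 2b)/2, exactly minus the coefficient
    -- of ‖D‖² in the limiting defect.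
    have h3 : Tendsto (fun t => (f₁ t - f₂ t) - ((H ^ 2 - ‖D‖ ^ 2) * (2 * A' t - S' t) +
        2 * (S' t - A' t) * H ^ 2)) l (𝓝 0) := by
      have h4 := (h1.sub h2).sub ((((hA'lim.const_mul 2).sub hS'lim).const_mul
        (H ^ 2 - ‖D‖ ^ 2)).add (((hS'lim.sub hA'lim).const_mul 2).mul_const (H ^ 2)))
      convert h4 using 2
      field_simp
      ring
    refine ((h.angularDefect_sub_isLittleO hc hsin).add (hη2 h3)).congr' ?_ (EventuallyEq.refl _ _)
    filter_upwards [hg, hSη, hAη, hs0] with t ht e1 e2 hst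
    have h5 : ∑ i : ZMod n, (curvElevation H D Z (F u) (P t) i *
        curvElevation H D Z (F u) (P t) (i + 1) - Real.cos (gammaAngle (F u) (P t) i) / 2 *
        (curvElevation H D Z (F u) (P t) i ^ 2 + curvElevation H D Z (F u) (P t) (i + 1) ^ 2)) /
        Real.sin (gammaAngle (F u) (P t) i) = η t ^ 2 * (f₁ t - f₂ t) := by
      rw [hf₁, hf₂, ← Finset.sum_sub_distrib, Finset.mul_sum]
      refine Finset.sum_congr rfl fun i _ => ?_
      have := (hst i).ne'
      rw [ht, ht]
      field_simp
      ring
    rw [h5, e1, e2]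
    ring
  · set f := fun t => ∑ i : ZMod n, 1 / (4 * Real.sin (gammaAngle (F u) (P t) i)) *
      (1 - Real.cos (gammaAngle (F u) (P t) i)) * (κ t i + κ t (i + 1) - 2 * H) with hf
    have h1 : Tendsto f l (𝓝 0) := by
      refine tendsto_sum_mul_of_bounded (B := 2 * (|H| + ‖D‖) + 2 * |H|)
        (fun i => (hinv i).mul ((hcosγ i).const_sub 1)) (fun t i => ?_) ?_
      · refine (abs_sub _ _).trans (add_le_add ((abs_add_le _ _).trans ?_) ?_)
        · linarith [hK t i, hK t (i + 1)]
        · rw [abs_mul, abs_two]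
      · filter_upwards [hκsum] with t ht
        rw [Finset.sum_sub_distrib, Finset.sum_add_distrib, hshift t fun x => x, ht.1]
        simp [ZMod.card]
        right
        ring
    have h2 : (fun t => (η t ^ 2 * (2 * f t)) • unitNormal F u) =o[l]
        fun t => totalLength (F u) (P t) ^ 2 := by
      have h3 := hη2 (f := fun t => 2 * f t) (by simpa using h1.const_mul 2)
      have h5 : (fun _ : ι => unitNormal F u) =O[l] fun _ => (1 : ℝ) := isBigO_const_const _
        one_ne_zero _
      simpa using h3.smul_isBigO h5
    refine ((h.sum_cotWeight_sub_isLittleO hc hsin).add h2).congr' ?_ (EventuallyEq.refl _ _)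
    filter_upwards [hg, hSη, hlen, hs0] with t ht e1 e2 hst
    rw [sub_add, ← sub_smul]
    congr 2
    rw [e1, hf, hS', Finset.mul_sum, Finset.mul_sum, Finset.mul_sum, Finset.mul_sum,
      ← Finset.sum_sub_distrib]
    refine Finset.sum_congr rfl fun i _ => ?_
    have := (hst i).ne'
    rw [ht, ht, e2, e2]
    field_simp
    ring

end

/-! ### Assembly of the two cases -/

theorem theorem2 (S : Set E3) (U : Set E2) (F : E2 → E3) (u₀ : E2)
    (hF : IsLocalParametrization S U F u₀) (n : ℕ)
    {ι : Type*} (l : Filter ι) (P : ι → ZMod n → E3)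
    (hP : ∀ᶠ t in l, IsOneRing S F u₀ (P t))
    (hη : ∀ i, Tendsto (fun t => edgeLength (F u₀) (P t) i) l (𝓝 0)) :
    (5 ≤ n → (∀ᶠ t in l, IsRegularVertex F u₀ (P t)) →
      Tendsto (fun t => gaussScheme (F u₀) (P t)) l (𝓝 (gaussianCurvature F u₀))) ∧
    (IsUmbilical F u₀ → (∃ c : ℝ, 0 < c ∧ ∀ᶠ t in l, IsNondegenerate c (F u₀) (P t)) →
      Tendsto (fun t => gaussScheme (F u₀) (P t)) l (𝓝 (gaussianCurvature F u₀))) := by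
  obtain ⟨Z, H, D, h1, h2, h3, hG, humb, hheight⟩ := hF.exists_tangent_coord
  have h : IsShrinkingFamily S F u₀ Z H D l P := ⟨⟨h1, h2, h3⟩, hheight, hP, hη⟩
  rcases Nat.eq_zero_or_pos n with rfl | hn
  -- For n = 0 the winding sum is empty and cannot equal 2π, so the filter is trivial.
  · have hl : l = ⊥ := by
      rw [← eventually_false_iff_eq_bot]
      filter_upwards [hP] with t ht
      have h4 := ht.winding
      simp only [Finset.Icc_eq_empty_of_lt zero_lt_one, Finset.sum_empty] at h4
      linarith [Real.pi_pos]
    rw [hl]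
    exact ⟨fun _ _ => tendsto_bot, fun _ _ => tendsto_bot⟩
  · have : NeZero n := ⟨hn.ne'⟩
    rw [hG]
    refine ⟨fun h5 hreg => tendsto_gaussScheme_of_regular h5 h hreg, ?_⟩
    rintro hu ⟨c, hc, hN⟩
    obtain rfl := humb hu
    rw [norm_zero, zero_pow two_ne_zero, sub_zero]
    exact tendsto_gaussScheme_of_umbilic h hc hN
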